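/- Let $1<p,q,r<\infty$ with $\frac1p+\frac1q+\frac1r=2$, let $r'=r/(r-1)$, and let $L_s=L_s(\mathbb{R}^d)$ denote the space of complex-valued functions with norm $\|\cdot\|_s$. Let $k\in L_q$ be nonzero (i.e. not almost everywhere zero), let $Kf=k*f$, that is, $Kf(x)=\int k(x-y)f(y)\,dy$, and let $\|K\|=\sup\{\|Kf\|_{r'} : f\in L_p,\ \|f\|_p=1\}$ be the norm of $K:L_p\to L_{r'}$. Write $T_af(x)=f(x-a)$ for $a\in\mathbb{R}^d$. Let $(f_n)$ be a maximizing sequence for $K$, that is, $f_n\in L_p$, $\|f_n\|_p=1$ for all $n$, and $\|Kf_n\|_{r'}\to\|K\|$. Then: 1. There are a subsequence $(f_{n_j})$ and vectors $a_j\in\mathbb{R}^d$ such that $T_{a_j}f_{n_j}$ converges in $L_p$ as $j\to\infty$. 2. Whenever $(f_{n_j})$ is a subsequence and $a_j\in\mathbb{R}^d$ are vectors such that $T_{a_j}f_{n_j}$ converges in $L_p$ to some $g$, the limit $g$ is a maximizer for $K$, that is, $\|g\|_p=1$ and $\|Kg\|_{r'}=\|K\|$. 3. The sequence $(f_n)$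 is shift-compact: there are vectors $a_n\in\mathbb{R}^d$ ($n\in\mathbb{N}$) such that the sequence $(T_{a_n}f_n)$ is relatively compact in $L_p$, i.e. each of its subsequences has a further subsequence that converges in $L_p$. -/

import Mathlib

open MeasureTheory Filter Topology
open scoped ENNReal

namespace ConvMax

/-- The convolution operator `K f = k * f` on complex functions on `ℝ^d`. -/
noncomputable def convOp {d : ℕ} (k f : EuclideanSpace ℝ (Fin d) → ℂ) :
    EuclideanSpace ℝ (Fin d) → ℂ :=
  convolution k f (ContinuousLinearMap.mul ℂ ℂ) volume

theorem convOp_apply {d : ℕ} (k f : EuclideanSpace ℝ (Fin d) → ℂ)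
    (x : EuclideanSpace ℝ (Fin d)) : convOp k f x = ∫ y, k (x - y) * f y :=
  convolution_mul_swap

/-- The exponent `r' = r / (r - 1)` conjugate to `r`, as an extended nonnegative real. -/
noncomputable def conjExp (r : ℝ) : ℝ≥0∞ := ENNReal.ofReal (Real.conjExponent r)

/-- `f` is an element of the unit sphere of `L_p(ℝ^d)`. -/
def IsUnitLp {d : ℕ} (p : ℝ) (f : EuclideanSpace ℝ (Fin d) → ℂ) : Prop :=
  MemLp f (ENNReal.ofReal p) volume ∧ eLpNorm f (ENNReal.ofReal p) volume = 1

/-- The norm of the convolution operator with kernel `k`, acting from `L_p` to `L_{r'}`: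
the supremum of `‖k * f‖_{r'}` over all `f` with `‖f‖_p = 1`. -/
noncomputable def convNorm {d : ℕ} (p r : ℝ) (k : EuclideanSpace ℝ (Fin d) → ℂ) : ℝ≥0∞ :=
  ⨆ (f : EuclideanSpace ℝ (Fin d) → ℂ) (_ : IsUnitLp p f),
    eLpNorm (convOp k f) (conjExp r) volume

/-- `f` is a maximizer: `‖f‖_p = 1` and `‖k * f‖_{r'} = ‖K‖`. -/
def IsMaximizer {d : ℕ} (p r : ℝ) (k f : EuclideanSpace ℝ (Fin d) → ℂ) : Prop :=
  IsUnitLp p f ∧ eLpNorm (convOp k f) (conjExp r) volume = convNorm p r k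

/-- `(f n)` is a maximizing sequence: `‖f n‖_p = 1` for all `n`, and `‖k * f n‖_{r'} → ‖K‖`. -/
def IsMaximizingSeq {d : ℕ} (p r : ℝ) (k : EuclideanSpace ℝ (Fin d) → ℂ)
    (f : ℕ → EuclideanSpace ℝ (Fin d) → ℂ) : Prop :=
  (∀ n, IsUnitLp p (f n)) ∧
    Tendsto (fun n => eLpNorm (convOp k (f n)) (conjExp r) volume) atTop (𝓝 (convNorm p r k))

/-- The translation `T_a f (x) = f (x - a)`. -/
def shift {d : ℕ} (a : EuclideanSpace ℝ (Fin d)) (f : EuclideanSpace ℝ (Fin d) → ℂ) :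
    EuclideanSpace ℝ (Fin d) → ℂ :=
  fun x => f (x - a)

/-- The sequence `(f n)` converges to `g ∈ L_p` in the norm of `L_p`. -/
def TendstoLp {d : ℕ} (p : ℝ) (f : ℕ → EuclideanSpace ℝ (Fin d) → ℂ)
    (g : EuclideanSpace ℝ (Fin d) → ℂ) : Prop :=
  MemLp g (ENNReal.ofReal p) volume ∧
    Tendsto (fun n => eLpNorm (f n - g) (ENNReal.ofReal p) volume) atTop (𝓝 0)

/-- `(f n)` is shift-compact in `L_p`: for suitable vectors `a n`, the sequence of translates
`T_{a n} (f n)` is relatively compact in `L_p`, that is, each of its subsequences has a further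
subsequence which converges in `L_p`. -/
def IsShiftCompact {d : ℕ} (p : ℝ) (f : ℕ → EuclideanSpace ℝ (Fin d) → ℂ) : Prop :=
  ∃ a : ℕ → EuclideanSpace ℝ (Fin d), ∀ ψ : ℕ → ℕ, StrictMono ψ →
    ∃ φ : ℕ → ℕ, StrictMono φ ∧ ∃ g : EuclideanSpace ℝ (Fin d) → ℂ,
      TendstoLp p (fun j => shift (a (ψ (φ j))) (f (ψ (φ j)))) g

end ConvMax

/-!
# Compactness of maximizing sequences of a convolution operator

Let `s = r'`, so that `1 / p + 1 / q = 1 + 1 / s` and in particular `p < s`. By Young's inequality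
`K f = k * f` is a bounded operator from `L_p` to `L_s`, and it commutes with translations; it is
nonzero because approximate identities recover `k` from the functions `k * f`.

*Concentration.* Suppose first that `k` is supported in a ball of radius `ρ`. On `ball z L` the
function `K f` depends only on `f_z`, the restriction of `f` to `ball z (L + ρ)`. If `M` bounds
`‖f_z‖_p` for all `z`, then
`∫_{ball z L} |K f| ^ s ≤ ‖K‖ ^ s ‖f_z‖_p ^ s ≤ ‖K‖ ^ s M ^ (s - p) ‖f_z‖_p ^ p`,
and integration over all centers `z` gives, for `‖f‖_p = 1`,
`L ^ d ‖K f‖_s ^ s ≤ ‖K‖ ^ s M ^ (s - p) (L + ρ) ^ d`.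
If `f` is nearly a maximizer and `L` is large then `M` must be close to `1`: almost the full mass
of `f` sits in one ball. A general kernel is approximated in `L_q` by continuous compactly
supported ones (`volume_ball_mul_eLpNorm_convOp_rpow_le`,
`exists_eventually_lt_eLpNorm_indicator_ball`). Two balls that carry more than half of the mass
intersect, so the maximizing sequence becomes tight after one translation for each of its members
(`exists_tight_centers`, `exists_shift_tight`).

*Compactness.* A tight bounded sequence has a totally bounded image under `K`, since `K` is
approximated by convolutions with continuous compactly supported kernels applied to functions
restricted to a fixed ball, and these are compact operators (`totallyBounded_range_convCLM`).
Hence `K f_n` converges along a subsequence. As `L_p` is uniformly convex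
(`uniformConvexSpace_Lp`), the `f_n` themselves form a Cauchy sequence there: `K (f_m + f_n)` has
norm close to `2 ‖K‖`, so `‖f_m + f_n‖_p` is close to `2`
(`cauchySeq_of_norm_tendsto_opNorm`). That limits are maximizers is the continuity of `K`.
-/

namespace ConvMax

/-! ### Uniform convexity of `L_p` -/

/-- Strict midpoint convexity of `‖·‖ ^ p`: from the strict convexity of `t ↦ t ^ p` if the norms
of `a` and `b` differ, and from that of the norm if they agree. -/
theorem norm_midpoint_rpow_lt {E : Type*} [NormedAddCommGroup E] [NormedSpace ℝ E]
    [StrictConvexSpace ℝ E] {p : ℝ} (hp : 1 < p) {a b : E} (hab : a ≠ b) :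
    ‖(1 / 2 : ℝ) • (a + b)‖ ^ p < (‖a‖ ^ p + ‖b‖ ^ p) / 2 := by
  have hp0 : 0 < p := by linarith
  have hn : ‖(1 / 2 : ℝ) • (a + b)‖ = ‖a + b‖ / 2 := by
    rw [norm_smul]; norm_num; ring
  rw [hn]
  rcases eq_or_ne ‖a‖ ‖b‖ with h | h
  · have hlt : ‖a + b‖ < ‖a‖ + ‖b‖ := by
      refine lt_of_le_of_ne (norm_add_le a b) fun hs => hab ?_
      exact (sameRay_iff_norm_add.2 hs).eq_of_norm_eq h
    have : (‖a + b‖ / 2) ^ p < ‖a‖ ^ p :=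
      Real.rpow_lt_rpow (by positivity) (by linarith) hp0
    rw [← h]; linarith
  · have hc := (strictConvexOn_rpow hp).2 (Set.mem_Ici.2 (norm_nonneg a))
      (Set.mem_Ici.2 (norm_nonneg b)) h (by norm_num : (0 : ℝ) < 1 / 2)
      (by norm_num : (0 : ℝ) < 1 / 2) (by norm_num)
    simp only [smul_eq_mul] at hc
    have hle : (‖a + b‖ / 2) ^ p ≤ (1 / 2 * ‖a‖ + 1 / 2 * ‖b‖) ^ p :=
      Real.rpow_le_rpow (by positivity) (by linarith [norm_add_le a b]) hp0.le
    linarith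

/-- A quantitative form of the strict convexity of `‖·‖ ^ p`. Integrated, it gives the uniform
convexity of `L_p`. All terms are homogeneous of degree `p`, so it suffices to treat the unit
sphere, where `‖a - b‖ ^ p` exceeds the `ε`-term only on a compact set on which the convexity gap
is bounded away from `0`. -/
theorem exists_norm_sub_rpow_le {E : Type*} [NormedAddCommGroup E] [NormedSpace ℝ E]
    [StrictConvexSpace ℝ E] [ProperSpace E] {p : ℝ} (hp : 1 < p) {ε : ℝ} (hε : 0 < ε) :
    ∃ C : ℝ, 0 ≤ C ∧ ∀ a b : E, ‖a - b‖ ^ p ≤ ε * (‖a‖ ^ p + ‖b‖ ^ p) +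
      C * ((‖a‖ ^ p + ‖b‖ ^ p) / 2 - ‖(1 / 2 : ℝ) • (a + b)‖ ^ p) := by
  have hp0 : 0 < p := by linarith
  have hcont : ∀ u : E × E → E, Continuous u → Continuous fun x => ‖u x‖ ^ p := fun u hu =>
    hu.norm.rpow_const fun _ => Or.inr hp0.le
  set F : E × E → ℝ := fun x => ‖x.1 - x.2‖ ^ p with hF
  set H : E × E → ℝ := fun x => ‖x.1‖ ^ p + ‖x.2‖ ^ p with hH
  set G : E × E → ℝ := fun x => H x / 2 - ‖(1 / 2 : ℝ) • (x.1 + x.2)‖ ^ p with hG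
  have hFc : Continuous F := hcont _ (by fun_prop)
  have hHc : Continuous H := (hcont _ continuous_fst).add (hcont _ continuous_snd)
  have hGc : Continuous G := (hHc.div_const 2).sub (hcont _ (by fun_prop))
  have hG0 : ∀ x, 0 ≤ G x := by
    rintro ⟨a, b⟩
    rcases eq_or_ne a b with rfl | h
    · have : (1 / 2 : ℝ) • (a + a) = a := by rw [← two_smul ℝ a, smul_smul]; norm_num
      simp only [hG, hH, this]
      linarith
    · exact sub_nonneg.2 (norm_midpoint_rpow_lt hp h).le
  -- the points of the unit sphere of `E × E` at which the first term alone does not suffice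
  set S : Set (E × E) := Metric.sphere 0 1 ∩ {x | ε * H x ≤ F x} with hS
  have hSc : IsCompact S := (isCompact_sphere 0 1).inter_right
    (isClosed_le (continuous_const.mul hHc) hFc)
  have hHpos : ∀ x : E × E, x ≠ 0 → 0 < H x := by
    rintro ⟨a, b⟩ hx
    by_cases ha : a = 0
    · have hb : b ≠ 0 := fun hb => hx (by simp [ha, hb])
      have := Real.rpow_pos_of_pos (norm_pos_iff.2 hb) p
      have := Real.rpow_nonneg (norm_nonneg a) p
      simp only [hH]; linarith
    · have := Real.rpow_pos_of_pos (norm_pos_iff.2 ha) p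
      have := Real.rpow_nonneg (norm_nonneg b) p
      simp only [hH]; linarith
  have hGpos : ∀ x ∈ S, 0 < G x := by
    rintro ⟨a, b⟩ ⟨hx1, hx2⟩
    have hx0 : ((a, b) : E × E) ≠ 0 := by
      intro h; rw [h] at hx1; simp at hx1
    have hab : a ≠ b := by
      rintro rfl
      have h1 := hHpos _ hx0
      have h2 : F (a, a) = 0 := by simp [hF, hp0.ne']
      have h3 : ε * H (a, a) ≤ F (a, a) := hx2
      rw [h2] at h3
      nlinarith
    exact sub_pos.2 (norm_midpoint_rpow_lt hp hab)
  obtain ⟨C, hC⟩ := hSc.bddAbove_image (f := fun x => F x / G x)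
    (hFc.continuousOn.div hGc.continuousOn fun x hx => (hGpos x hx).ne')
  have hsphere : ∀ x : E × E, ‖x‖ = 1 → F x ≤ ε * H x + max C 0 * G x := by
    intro x hx
    by_cases hxS : ε * H x ≤ F x
    · have hxm : x ∈ S := ⟨by simpa using hx, hxS⟩
      have h1 : F x / G x ≤ max C 0 := (hC ⟨x, hxm, rfl⟩).trans (le_max_left _ _)
      rw [div_le_iff₀ (hGpos x hxm)] at h1
      have : 0 ≤ ε * H x := mul_nonneg hε.le (by simp only [hH]; positivity)
      linarith
    · have := mul_nonneg (le_max_right C 0) (hG0 x)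
      linarith
  refine ⟨max C 0, le_max_right _ _, fun a b => ?_⟩
  by_cases hx : ((a, b) : E × E) = 0
  · obtain ⟨rfl, rfl⟩ := Prod.mk_eq_zero.1 hx
    simp [hp0.ne']
  -- all terms are homogeneous of degree `p`
  set t := ‖((a, b) : E × E)‖ with ht
  have ht0 : 0 < t := norm_pos_iff.2 hx
  have hsc : ∀ u : E, ‖t⁻¹ • u‖ ^ p = t⁻¹ ^ p * ‖u‖ ^ p := fun u => by
    rw [norm_smul, Real.norm_of_nonneg (inv_nonneg.2 ht0.le),
      Real.mul_rpow (inv_nonneg.2 ht0.le) (norm_nonneg u)]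
  have h := hsphere (t⁻¹ • (a, b)) (by
    rw [norm_smul, Real.norm_of_nonneg (inv_nonneg.2 ht0.le), inv_mul_cancel₀ ht0.ne'])
  simp only [hF, hH, hG, Prod.smul_mk, ← smul_sub, ← smul_add, smul_comm (1 / 2 : ℝ) t⁻¹,
    hsc] at h
  have hpos : 0 < t⁻¹ ^ p := Real.rpow_pos_of_pos (inv_pos.2 ht0) p
  refine le_of_mul_le_mul_left (h.trans_eq ?_) hpos
  ring

theorem Lp_norm_rpow_eq_integral {α E : Type*} [MeasurableSpace α] {μ : Measure α}
    [NormedAddCommGroup E] {p : ℝ} (hp : 0 < p) (f : Lp E (ENNReal.ofReal p) μ) :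
    ‖f‖ ^ p = ∫ x, ‖f x‖ ^ p ∂μ := by
  have h := (Lp.memLp f).eLpNorm_eq_integral_rpow_norm (by simpa using hp) ENNReal.ofReal_ne_top
  have hi : 0 ≤ ∫ x, ‖f x‖ ^ p ∂μ := integral_nonneg fun x => by positivity
  rw [ENNReal.toReal_ofReal hp.le] at h
  rw [Lp.norm_def, h, ENNReal.toReal_ofReal (by positivity), Real.rpow_inv_rpow hi hp.ne']

/-- `L_p` is uniformly convex for `1 < p < ∞`. -/
theorem uniformConvexSpace_Lp {α E : Type*} [MeasurableSpace α] {μ : Measure α}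
    [NormedAddCommGroup E] [NormedSpace ℝ E] [StrictConvexSpace ℝ E] [ProperSpace E]
    {p : ℝ} (hp : 1 < p) [Fact (1 ≤ ENNReal.ofReal p)] :
    UniformConvexSpace (Lp E (ENNReal.ofReal p) μ) := by
  have hp0 : 0 < p := by linarith
  refine ⟨fun ε hε => ?_⟩
  have hεp : 0 < ε ^ p := Real.rpow_pos_of_pos hε p
  obtain ⟨C, hC0, hC⟩ := exists_norm_sub_rpow_le (E := E) hp (ε := ε ^ p / 4) (by positivity)
  -- `δ` is chosen so that `2 - δ < ‖x + y‖` forces `C * (1 - ‖(x + y) / 2‖ ^ p) < ε ^ p / 2`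
  obtain ⟨δ, hδ, hδC⟩ : ∃ δ : ℝ, 0 < δ ∧ C * (1 - (1 - δ / 2) ^ p) < ε ^ p / 2 ∧ δ < 1 := by
    have hlim : Tendsto (fun δ : ℝ => C * (1 - (1 - δ / 2) ^ p)) (𝓝 0) (𝓝 0) := by
      have : Continuous fun δ : ℝ => C * (1 - (1 - δ / 2) ^ p) := by
        refine continuous_const.mul (continuous_const.sub ?_)
        exact Continuous.rpow_const (by fun_prop) fun _ => Or.inr hp0.le
      simpa using this.tendsto 0
    have h1 : ∀ᶠ δ : ℝ in 𝓝[>] 0, C * (1 - (1 - δ / 2) ^ p) < ε ^ p / 2 ∧ δ < 1 :=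
      nhdsWithin_le_nhds ((hlim.eventually_lt_const (by positivity)).and
        (eventually_lt_nhds one_pos))
    obtain ⟨δ, h, h'⟩ := (h1.and self_mem_nhdsWithin).exists
    exact ⟨δ, h', h⟩
  refine ⟨δ, hδ, fun x hx y hy hxy => ?_⟩
  by_contra! hlt
  have hint : ∀ z : Lp E (ENNReal.ofReal p) μ, Integrable (fun a => ‖z a‖ ^ p) μ := fun z => by
    have := (Lp.memLp z).integrable_norm_rpow (by simpa using hp0) ENNReal.ofReal_ne_top
    rwa [ENNReal.toReal_ofReal hp0.le] at this
  set m : Lp E (ENNReal.ofReal p) μ := (1 / 2 : ℝ) • (x + y) with hm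
  have key : ‖x - y‖ ^ p ≤ ε ^ p / 4 * (‖x‖ ^ p + ‖y‖ ^ p) +
      C * ((‖x‖ ^ p + ‖y‖ ^ p) / 2 - ‖m‖ ^ p) := by
    simp only [Lp_norm_rpow_eq_integral hp0]
    have hs : Integrable (fun a => ‖x a‖ ^ p + ‖y a‖ ^ p) μ := (hint x).add (hint y)
    have hd : Integrable (fun a => (‖x a‖ ^ p + ‖y a‖ ^ p) / 2 - ‖m a‖ ^ p) μ :=
      (hs.div_const 2).sub (hint m)
    rw [← integral_add (hint x) (hint y), ← integral_const_mul, ← integral_div,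
      ← integral_sub (hs.div_const 2) (hint m), ← integral_const_mul,
      ← integral_add (hs.const_mul _) (hd.const_mul C)]
    refine integral_mono_ae (hint _) ((hs.const_mul _).add (hd.const_mul C)) ?_
    filter_upwards [Lp.coeFn_sub x y, Lp.coeFn_smul (1 / 2 : ℝ) (x + y),
      Lp.coeFn_add x y] with a h1 h2 h3
    have h4 : m a = (1 / 2 : ℝ) • (x a + y a) := by rw [hm, h2, Pi.smul_apply, h3]; rfl
    simp only [h1, h4, Pi.sub_apply]
    exact hC (x a) (y a)
  have hmn : ‖m‖ = ‖x + y‖ / 2 := by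
    rw [hm, norm_smul]; norm_num; ring
  have hge : (1 - δ / 2) ^ p ≤ ‖m‖ ^ p :=
    Real.rpow_le_rpow (by linarith [hδC.2]) (by rw [hmn]; linarith) hp0.le
  have hge2 : ε ^ p ≤ ‖x - y‖ ^ p := Real.rpow_le_rpow hε.le hxy hp0.le
  rw [hx, hy, Real.one_rpow] at key
  have := mul_le_mul_of_nonneg_left hge hC0
  linarith [hδC.1]

/-- In a uniformly convex space, a maximizing sequence of unit vectors for an operator is Cauchy
as soon as its image is. -/
theorem cauchySeq_of_norm_tendsto_opNorm {𝕜 X Y : Type*} [RCLike 𝕜]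
    [NormedAddCommGroup X] [NormedSpace 𝕜 X] [UniformConvexSpace X]
    [NormedAddCommGroup Y] [NormedSpace 𝕜 Y] (T : X →L[𝕜] Y) (hT : T ≠ 0) {x : ℕ → X}
    (hx : ∀ n, ‖x n‖ = 1) (hlim : Tendsto (fun n => ‖T (x n)‖) atTop (𝓝 ‖T‖))
    (hc : CauchySeq fun n => T (x n)) : CauchySeq x := by
  have hT0 : 0 < ‖T‖ := norm_pos_iff.2 hT
  refine Metric.cauchySeq_iff.2 fun ε hε => ?_
  obtain ⟨δ, hδ, hδ'⟩ := exists_forall_sphere_dist_add_le_two_sub X hε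
  have hη : 0 < ‖T‖ * δ / 4 := by positivity
  obtain ⟨n₁, h₁⟩ := Metric.cauchySeq_iff.1 hc _ hη
  obtain ⟨n₂, h₂⟩ := eventually_atTop.1 (hlim.eventually_const_lt
    (show ‖T‖ - ‖T‖ * δ / 4 < ‖T‖ by linarith))
  refine ⟨max n₁ n₂, fun m hm n hn => ?_⟩
  by_contra! hle
  rw [dist_eq_norm] at hle
  have h3 := hδ' (hx m) (hx n) hle
  have h4 := h₁ m (le_of_max_le_left hm) n (le_of_max_le_left hn)
  rw [dist_eq_norm] at h4
  have h5 := h₂ m (le_of_max_le_right hm)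
  have h6 : ‖T (x m) + T (x n)‖ ≤ ‖T‖ * (2 - δ) := by
    rw [← map_add]
    exact (T.le_opNorm _).trans (mul_le_mul_of_nonneg_left h3 hT0.le)
  have h7 : ‖T (x m) + T (x m)‖ ≤ ‖T (x m) + T (x n)‖ + ‖T (x m) - T (x n)‖ := by
    refine le_trans (le_of_eq ?_) (norm_add_le _ _)
    congr 1; abel
  have h8 : ‖T (x m) + T (x m)‖ = 2 * ‖T (x m)‖ := by
    rw [← two_smul 𝕜, norm_smul, RCLike.norm_ofNat]
  nlinarith

/-! ### Tightness and equicontinuity -/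

/-- If for each `θ < 1` all but finitely many `ν n` give mass more than `θ` to some ball of a
radius independent of `n`, then the sequence is uniformly tight about suitable centers. The centers
are those of balls of mass more than `1 / 2`, which every ball of larger mass has to intersect. -/
theorem exists_tight_centers {X : Type*} [PseudoMetricSpace X] [MeasurableSpace X]
    [OpensMeasurableSpace X] [Nonempty X] (ν : ℕ → Measure X) [∀ n, IsProbabilityMeasure (ν n)]
    (H : ∀ θ : ℝ≥0∞, θ < 1 → ∃ R, ∀ᶠ n in atTop, ∃ z, θ < ν n (Metric.ball z R)) :
    ∃ a : ℕ → X, ∀ η : ℝ≥0∞, 0 < η → ∃ R, ∀ n, ν n (Metric.ball (a n) R)ᶜ ≤ η := by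
  obtain ⟨R₀, h₀⟩ := H (1 / 2) (by simp)
  have : ∀ n, ∃ a : X, (∃ z, 1 / 2 < ν n (Metric.ball z R₀)) → 1 / 2 < ν n (Metric.ball a R₀) := by
    intro n
    by_cases h : ∃ z, 1 / 2 < ν n (Metric.ball z R₀)
    · exact h.imp fun z hz _ => hz
    · exact ⟨Classical.arbitrary X, fun h' => absurd h' h⟩
  choose a ha using this
  refine ⟨a, fun η hη => ?_⟩
  obtain ⟨R, hR⟩ := H (max (1 / 2) (1 - η))
    (max_lt (by simp) (ENNReal.sub_lt_self ENNReal.one_ne_top one_ne_zero hη.ne'))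
  have hev : ∀ᶠ n in atTop, ν n (Metric.ball (a n) (R₀ + 2 * R))ᶜ ≤ η := by
    filter_upwards [h₀, hR] with n hn ⟨z, hz⟩
    have han := ha n hn
    -- two balls of measure greater than `1 / 2` cannot be disjoint
    have hne : ¬ Disjoint (Metric.ball (a n) R₀) (Metric.ball z R) := fun hd => by
      have h1 := measure_union (μ := ν n) hd Metric.isOpen_ball.measurableSet
      have h2 := ENNReal.add_lt_add han ((le_max_left _ _).trans_lt hz)
      rw [ENNReal.add_halves, ← h1] at h2
      exact absurd prob_le_one (not_le.2 h2)
    obtain ⟨y, hy1, hy2⟩ := Set.not_disjoint_iff.1 hne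
    have hsub : Metric.ball z R ⊆ Metric.ball (a n) (R₀ + 2 * R) := fun x hx => by
      rw [Metric.mem_ball] at *
      have := dist_triangle4 x z y (a n)
      rw [dist_comm z y] at this
      linarith
    rw [prob_compl_eq_one_sub Metric.isOpen_ball.measurableSet, tsub_le_iff_left,
      ← tsub_le_iff_right]
    exact (le_max_right _ _).trans (hz.le.trans (measure_mono hsub))
  -- the finitely many remaining measures are tight one by one
  have hone : ∀ n, ∃ R, ν n (Metric.ball (a n) R)ᶜ ≤ η := fun n => by
    have hlim := tendsto_measure_iInter_atTop (μ := ν n)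
      (s := fun m : ℕ => (Metric.ball (a n) m)ᶜ)
      (fun m => Metric.isOpen_ball.measurableSet.compl.nullMeasurableSet)
      (fun i j hij => Set.compl_subset_compl.2 (Metric.ball_subset_ball (by exact_mod_cast hij)))
      ⟨0, measure_ne_top _ _⟩
    have hempty : ⋂ m : ℕ, (Metric.ball (a n) (m : ℝ))ᶜ = ∅ := by
      rw [← Set.compl_iUnion, Metric.iUnion_ball_nat, Set.compl_univ]
    rw [hempty, measure_empty] at hlim
    obtain ⟨m, hm⟩ := (hlim.eventually_le_const hη).exists
    exact ⟨m, hm⟩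
  choose S hS using hone
  obtain ⟨n₀, hn₀⟩ := eventually_atTop.1 hev
  obtain ⟨M, hM⟩ := ((Finset.range n₀).image S).exists_le
  have hmono : ∀ n {R R' : ℝ}, R ≤ R' →
      ν n (Metric.ball (a n) R')ᶜ ≤ ν n (Metric.ball (a n) R)ᶜ := fun n _ _ h =>
    measure_mono (Set.compl_subset_compl.2 (Metric.ball_subset_ball h))
  refine ⟨max M (R₀ + 2 * R), fun n => ?_⟩
  rcases lt_or_ge n n₀ with hn | hn
  · refine (hmono n ?_).trans (hS n)
    exact (hM _ (Finset.mem_image_of_mem S (Finset.mem_range.2 hn))).trans (le_max_left _ _)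
  · exact (hmono n (le_max_right _ _)).trans (hn₀ n hn)

/-- A form of the Arzelà–Ascoli theorem: a bounded, uniformly equicontinuous family of functions
that vanish outside a common compact set has finite nets in the supremum norm. -/
theorem exists_finite_net_of_equicontinuous {ι X : Type*} [PseudoMetricSpace X] {u : ι → X → ℂ}
    {D : Set X} (hD : IsCompact D) (hzero : ∀ i, ∀ x ∉ D, u i x = 0)
    (hequi : ∀ η > 0, ∃ δ > 0, ∀ i x x', dist x x' < δ → ‖u i x - u i x'‖ ≤ η)
    {A : ℝ} (hA : ∀ i x, ‖u i x‖ ≤ A) {η : ℝ} (hη : 0 < η) :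
    ∃ t : Set ι, t.Finite ∧ ∀ i, ∃ j ∈ t, ∀ x, ‖u i x - u j x‖ ≤ η := by
  obtain ⟨δ, hδ, hδu⟩ := hequi (η / 3) (by positivity)
  obtain ⟨P, -, hPfin, hP⟩ := Metric.finite_approx_of_totallyBounded hD.totallyBounded δ hδ
  have := hPfin.fintype
  -- the values at the finitely many points of `P`
  let v : ι → P → ℂ := fun i x => u i x
  have hv : TotallyBounded (Set.range v) := by
    refine (isCompact_closedBall (0 : P → ℂ) (max A 0)).totallyBounded.subset ?_
    rintro _ ⟨i, rfl⟩
    rw [mem_closedBall_zero_iff, pi_norm_le_iff_of_nonneg (le_max_right _ _)]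
    exact fun x => (hA i x).trans (le_max_left _ _)
  obtain ⟨t, htv, htfin, ht⟩ := Metric.finite_approx_of_totallyBounded hv (η / 3) (by positivity)
  have := htfin.fintype
  let g : t → ι := fun y => (htv y.2).choose
  have hg : ∀ y : t, v (g y) = y := fun y => (htv y.2).choose_spec
  refine ⟨Set.range g, Set.finite_range g, fun i => ?_⟩
  obtain ⟨y, hy, hiy⟩ := Set.mem_iUnion₂.1 (ht ⟨i, rfl⟩)
  refine ⟨g ⟨y, hy⟩, ⟨_, rfl⟩, fun x => ?_⟩
  by_cases hx : x ∈ D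
  · obtain ⟨z, hz, hxz⟩ := Set.mem_iUnion₂.1 (hP hx)
    have h1 := hδu i x z hxz
    have h2 := hδu (g ⟨y, hy⟩) x z hxz
    have h3 : ‖u i z - u (g ⟨y, hy⟩) z‖ ≤ η / 3 := by
      have h4 := (dist_le_pi_dist (v i) y ⟨z, hz⟩).trans (Metric.mem_ball.1 hiy).le
      have h5 : v (g ⟨y, hy⟩) = y := hg ⟨y, hy⟩
      rwa [← h5, dist_eq_norm] at h4
    have h5 : u i x - u (g ⟨y, hy⟩) x = (u i x - u i z) + (u i z - u (g ⟨y, hy⟩) z) -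
        (u (g ⟨y, hy⟩) x - u (g ⟨y, hy⟩) z) := by ring
    rw [h5]
    refine (norm_sub_le _ _).trans ?_
    have := norm_add_le (u i x - u i z) (u i z - u (g ⟨y, hy⟩) z)
    linarith
  · rw [hzero i x hx, hzero _ x hx]
    simpa using hη.le

/-! ### Exponents in Young's inequality -/

/-- Exponents `1 < p, q` and `0 < s` with `1 / p + 1 / q = 1 + 1 / s`, for which convolution with
a kernel in `L_q` maps `L_p` to `L_s`. -/
structure YoungTriple (p q s : ℝ) : Prop where
  one_lt_left : 1 < p
  one_lt_right : 1 < q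
  pos : 0 < s
  inv_add_inv : p⁻¹ + q⁻¹ = 1 + s⁻¹

namespace YoungTriple

variable {p q s : ℝ}

theorem left_pos (h : YoungTriple p q s) : 0 < p := one_pos.trans h.one_lt_left

theorem right_pos (h : YoungTriple p q s) : 0 < q := one_pos.trans h.one_lt_right

theorem left_lt (h : YoungTriple p q s) : p < s := by
  have h1 := inv_lt_one_of_one_lt₀ h.one_lt_right
  have h2 := h.inv_add_inv
  exact (inv_lt_inv₀ h.pos h.left_pos).1 (by linarith)

theorem right_lt (h : YoungTriple p q s) : q < s := by
  have h1 := inv_lt_one_of_one_lt₀ h.one_lt_left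
  have h2 := h.inv_add_inv
  exact (inv_lt_inv₀ h.pos h.right_pos).1 (by linarith)

theorem one_lt (h : YoungTriple p q s) : 1 < s := h.one_lt_left.trans h.left_lt

theorem fact_left (h : YoungTriple p q s) : Fact (1 ≤ ENNReal.ofReal p) :=
  ⟨by simpa using h.one_lt_left.le⟩

theorem fact_out (h : YoungTriple p q s) : Fact (1 ≤ ENNReal.ofReal s) :=
  ⟨by simpa using h.one_lt.le⟩

end YoungTriple

theorem youngTriple_conjExponent {p q r : ℝ} (hp : 1 < p) (hq : 1 < q) (hr : 1 < r)
    (hpqr : 1 / p + 1 / q + 1 / r = 2) : YoungTriple p q (Real.conjExponent r) := by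
  have hc := Real.HolderConjugate.conjExponent hr
  refine ⟨hp, hq, hc.symm.pos, ?_⟩
  have := hc.inv_add_inv_eq_one
  simp only [one_div] at hpqr
  linarith

/-! ### Young's inequality -/

theorem eLpNorm_ofReal_rpow {α F : Type*} [MeasurableSpace α] {μ : Measure α}
    [NormedAddCommGroup F] {p : ℝ} (hp : 0 < p) (f : α → F) :
    eLpNorm f (ENNReal.ofReal p) μ ^ p = ∫⁻ x, ‖f x‖ₑ ^ p ∂μ := by
  rw [eLpNorm_eq_lintegral_rpow_enorm_toReal (by simpa using hp) ENNReal.ofReal_ne_top,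
    ENNReal.toReal_ofReal hp.le, ← ENNReal.rpow_mul, one_div, inv_mul_cancel₀ hp.ne',
    ENNReal.rpow_one]

section Convolution

variable {d : ℕ} {p q s : ℝ}

local notation "𝔼" => EuclideanSpace ℝ (Fin d)

theorem aemeasurable_comp_sub {κ : 𝔼 → ℝ≥0∞} (hκ : AEMeasurable κ volume) :
    AEMeasurable (fun z : 𝔼 × 𝔼 => κ (z.1 - z.2)) (volume.prod volume) :=
  hκ.comp_quasiMeasurePreserving (quasiMeasurePreserving_sub_of_right_invariant volume volume)

/-- The integral of a convolution is the product of the integrals. -/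
theorem lintegral_lintegral_sub_mul {κ φ : 𝔼 → ℝ≥0∞} (hκ : AEMeasurable κ volume)
    (hφ : AEMeasurable φ volume) :
    ∫⁻ x, ∫⁻ y, κ (x - y) * φ y = (∫⁻ x, κ x) * ∫⁻ y, φ y := by
  rw [lintegral_lintegral_swap]
  · simp_rw [← lintegral_const_mul'' _ hφ]
    refine lintegral_congr fun y => ?_
    have hm : AEMeasurable (fun x => κ (x - y)) volume :=
      hκ.comp_quasiMeasurePreserving (measurePreserving_sub_right volume y).quasiMeasurePreserving
    rw [lintegral_mul_const'' _ hm, lintegral_sub_right_eq_self κ y]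
  · exact (aemeasurable_comp_sub hκ).mul hφ.comp_snd

/-- The pointwise Hölder estimate behind Young's inequality: with `κ φ` written as the product of
`(κ ^ q φ ^ p) ^ (1 / s)`, `(κ ^ q) ^ (1 / q - 1 / s)` and `(φ ^ p) ^ (1 / p - 1 / s)`, whose
exponents add up to `1`. -/
theorem lintegral_sub_mul_rpow_le (h : YoungTriple p q s) {κ φ : 𝔼 → ℝ≥0∞}
    (hκ : AEMeasurable κ volume) (hφ : AEMeasurable φ volume) (x : 𝔼) :
    (∫⁻ y, κ (x - y) * φ y) ^ s ≤ (∫⁻ y, κ (x - y) ^ q * φ y ^ p) *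
      ((∫⁻ y, κ y ^ q) ^ (s / q - 1) * (∫⁻ y, φ y ^ p) ^ (s / p - 1)) := by
  have hp := h.left_pos
  have hq := h.right_pos
  have hs := h.pos
  have hps : 0 ≤ p⁻¹ - s⁻¹ := sub_nonneg.2 ((inv_le_inv₀ hs hp).2 h.left_lt.le)
  have hqs : 0 ≤ q⁻¹ - s⁻¹ := sub_nonneg.2 ((inv_le_inv₀ hs hq).2 h.right_lt.le)
  have hκx : AEMeasurable (fun y => κ (x - y)) volume :=
    hκ.comp_quasiMeasurePreserving (quasiMeasurePreserving_sub_left volume x)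
  have hH := ENNReal.lintegral_prod_norm_pow_le (μ := (volume : Measure 𝔼)) Finset.univ
    (f := ![fun y => κ (x - y) ^ q * φ y ^ p, fun y => κ (x - y) ^ q, fun y => φ y ^ p])
    (p := ![s⁻¹, q⁻¹ - s⁻¹, p⁻¹ - s⁻¹])
    (by
      intro i _
      fin_cases i
      · exact (hκx.pow_const q).mul (hφ.pow_const p)
      · exact hκx.pow_const q
      · exact hφ.pow_const p)
    (by
      simp only [Fin.sum_univ_three, Matrix.cons_val]
      linarith [h.inv_add_inv])
    (by
      intro i _
      fin_cases i
      · exact inv_nonneg.2 hs.le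
      · exact hqs
      · exact hps)
  simp only [Fin.prod_univ_three, Matrix.cons_val] at hH
  have hint : ∀ y, (κ (x - y) ^ q * φ y ^ p) ^ s⁻¹ * (κ (x - y) ^ q) ^ (q⁻¹ - s⁻¹) *
      (φ y ^ p) ^ (p⁻¹ - s⁻¹) = κ (x - y) * φ y := fun y => by
    have hcomb : ∀ (a : ℝ≥0∞) {t : ℝ}, 0 < t → 0 ≤ t⁻¹ - s⁻¹ →
        (a ^ t) ^ s⁻¹ * (a ^ t) ^ (t⁻¹ - s⁻¹) = a := fun a t ht hts => by
      rw [← ENNReal.rpow_add_of_nonneg _ _ (inv_nonneg.2 hs.le) hts, add_sub_cancel,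
        ENNReal.rpow_rpow_inv ht.ne']
    rw [ENNReal.mul_rpow_of_nonneg _ _ (inv_nonneg.2 hs.le),
      mul_right_comm ((κ (x - y) ^ q) ^ s⁻¹), hcomb _ hq hqs, mul_assoc, hcomb _ hp hps]
  simp_rw [hint] at hH
  refine (ENNReal.rpow_le_rpow hH hs.le).trans_eq ?_
  rw [ENNReal.mul_rpow_of_nonneg _ _ hs.le, ENNReal.mul_rpow_of_nonneg _ _ hs.le,
    ENNReal.rpow_inv_rpow hs.ne', ← ENNReal.rpow_mul, ← ENNReal.rpow_mul, mul_assoc,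
    lintegral_sub_left_eq_self (fun y => κ y ^ q) x]
  congr 3 <;> field_simp

/-- **Young's inequality** for nonnegative functions. -/
theorem lintegral_lintegral_sub_mul_rpow_le (h : YoungTriple p q s) {κ φ : 𝔼 → ℝ≥0∞}
    (hκ : AEMeasurable κ volume) (hφ : AEMeasurable φ volume) :
    ∫⁻ x, (∫⁻ y, κ (x - y) * φ y) ^ s ≤
      (∫⁻ y, κ y ^ q) ^ (s / q) * (∫⁻ y, φ y ^ p) ^ (s / p) := by
  have hp := h.left_pos
  have hq := h.right_pos
  have hF : AEMeasurable (fun x => ∫⁻ y, κ (x - y) ^ q * φ y ^ p) volume :=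
    AEMeasurable.lintegral_prod_right'
      (f := fun z : 𝔼 × 𝔼 => κ (z.1 - z.2) ^ q * φ z.2 ^ p)
      (((aemeasurable_comp_sub hκ).pow_const q).mul (hφ.comp_snd.pow_const p))
  refine (lintegral_mono (lintegral_sub_mul_rpow_le h hκ hφ)).trans_eq ?_
  rw [lintegral_mul_const'' _ hF, lintegral_lintegral_sub_mul (hκ.pow_const q) (hφ.pow_const p)]
  have hpow : ∀ (A : ℝ≥0∞) {t : ℝ}, 1 < t → A * A ^ (t - 1) = A ^ t := fun A t ht => by
    nth_rewrite 1 [← ENNReal.rpow_one A]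
    rw [← ENNReal.rpow_add_of_nonneg _ _ zero_le_one (by linarith)]
    congr 1; ring
  rw [mul_mul_mul_comm, hpow _ ((one_lt_div hq).2 h.right_lt),
    hpow _ ((one_lt_div hp).2 h.left_lt)]

theorem aemeasurable_lintegral_enorm_sub_mul {k f : 𝔼 → ℂ} (hk : AEStronglyMeasurable k volume)
    (hf : AEStronglyMeasurable f volume) :
    AEMeasurable (fun x => ∫⁻ y, ‖k (x - y)‖ₑ * ‖f y‖ₑ) volume :=
  AEMeasurable.lintegral_prod_right' (f := fun z : 𝔼 × 𝔼 => ‖k (z.1 - z.2)‖ₑ * ‖f z.2‖ₑ)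
    ((aemeasurable_comp_sub hk.enorm).mul hf.enorm.comp_snd)

theorem aestronglyMeasurable_convOp {k f : 𝔼 → ℂ} (hk : AEStronglyMeasurable k volume)
    (hf : AEStronglyMeasurable f volume) : AEStronglyMeasurable (convOp k f) volume := by
  have : convOp k f = fun x => ∫ y, k (x - y) * f y := funext (convOp_apply k f)
  rw [this]
  exact AEStronglyMeasurable.integral_prod_right' (f := fun z : 𝔼 × 𝔼 => k (z.1 - z.2) * f z.2)
    ((hk.comp_quasiMeasurePreserving
      (quasiMeasurePreserving_sub_of_right_invariant volume volume)).mul hf.comp_snd)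

theorem lintegral_lintegral_enorm_rpow_le (h : YoungTriple p q s) {k f : 𝔼 → ℂ}
    (hk : AEStronglyMeasurable k volume) (hf : AEStronglyMeasurable f volume) :
    ∫⁻ x, (∫⁻ y, ‖k (x - y)‖ₑ * ‖f y‖ₑ) ^ s ≤
      (eLpNorm k (ENNReal.ofReal q) volume * eLpNorm f (ENNReal.ofReal p) volume) ^ s := by
  refine (lintegral_lintegral_sub_mul_rpow_le h hk.enorm hf.enorm).trans_eq ?_
  rw [← eLpNorm_ofReal_rpow h.left_pos, ← eLpNorm_ofReal_rpow h.right_pos, ← ENNReal.rpow_mul,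
    ← ENNReal.rpow_mul, mul_div_cancel₀ _ h.left_pos.ne', mul_div_cancel₀ _ h.right_pos.ne',
    ENNReal.mul_rpow_of_nonneg _ _ h.pos.le]

/-- **Young's inequality** for the convolution operator. -/
theorem eLpNorm_convOp_le (h : YoungTriple p q s) {k f : 𝔼 → ℂ}
    (hk : AEStronglyMeasurable k volume) (hf : AEStronglyMeasurable f volume) :
    eLpNorm (convOp k f) (ENNReal.ofReal s) volume ≤
      eLpNorm k (ENNReal.ofReal q) volume * eLpNorm f (ENNReal.ofReal p) volume := by
  rw [← ENNReal.rpow_le_rpow_iff h.pos, eLpNorm_ofReal_rpow h.pos]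
  refine le_trans (lintegral_mono fun x => ?_) (lintegral_lintegral_enorm_rpow_le h hk hf)
  refine ENNReal.rpow_le_rpow ?_ h.pos.le
  rw [convOp_apply]
  refine (enorm_integral_le_lintegral_enorm _).trans_eq ?_
  simp_rw [enorm_mul]

theorem ae_integrable_sub_mul (h : YoungTriple p q s) {k f : 𝔼 → ℂ}
    (hk : MemLp k (ENNReal.ofReal q) volume) (hf : MemLp f (ENNReal.ofReal p) volume) :
    ∀ᵐ x : 𝔼, Integrable fun y => k (x - y) * f y := by
  have hlt : ∫⁻ x, (∫⁻ y, ‖k (x - y)‖ₑ * ‖f y‖ₑ) ^ s < ⊤ :=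
    (lintegral_lintegral_enorm_rpow_le h hk.1 hf.1).trans_lt
      (ENNReal.rpow_lt_top_of_nonneg h.pos.le (ENNReal.mul_lt_top hk.2 hf.2).ne)
  filter_upwards [ae_lt_top' ((aemeasurable_lintegral_enorm_sub_mul hk.1 hf.1).pow_const s)
    hlt.ne] with x hx
  refine ⟨(hk.1.comp_quasiMeasurePreserving (quasiMeasurePreserving_sub_left volume x)).mul hf.1,
    ?_⟩
  rw [hasFiniteIntegral_iff_enorm]
  simp_rw [enorm_mul]
  exact (ENNReal.rpow_lt_top_iff_of_pos h.pos).1 hx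

/-! ### The convolution operator on `L_p` -/

theorem memLp_convOp (h : YoungTriple p q s) {k f : 𝔼 → ℂ}
    (hk : MemLp k (ENNReal.ofReal q) volume) (hf : MemLp f (ENNReal.ofReal p) volume) :
    MemLp (convOp k f) (ENNReal.ofReal s) volume :=
  ⟨aestronglyMeasurable_convOp hk.1 hf.1,
    (eLpNorm_convOp_le h hk.1 hf.1).trans_lt (ENNReal.mul_lt_top hk.2 hf.2)⟩

theorem convOp_congr_right (k : 𝔼 → ℂ) {f g : 𝔼 → ℂ} (hfg : f =ᵐ[volume] g) :
    convOp k f = convOp k g := by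
  ext x
  simp_rw [convOp_apply]
  refine integral_congr_ae ?_
  filter_upwards [hfg] with y hy
  rw [hy]

theorem convOp_add_right (h : YoungTriple p q s) {k f g : 𝔼 → ℂ}
    (hk : MemLp k (ENNReal.ofReal q) volume) (hf : MemLp f (ENNReal.ofReal p) volume)
    (hg : MemLp g (ENNReal.ofReal p) volume) :
    convOp k (f + g) =ᵐ[volume] convOp k f + convOp k g := by
  filter_upwards [ae_integrable_sub_mul h hk hf, ae_integrable_sub_mul h hk hg] with x h1 h2
  simp only [Pi.add_apply, convOp_apply, mul_add]
  exact integral_add h1 h2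

theorem convOp_sub_left (h : YoungTriple p q s) {k l f : 𝔼 → ℂ}
    (hk : MemLp k (ENNReal.ofReal q) volume) (hl : MemLp l (ENNReal.ofReal q) volume)
    (hf : MemLp f (ENNReal.ofReal p) volume) :
    convOp (k - l) f =ᵐ[volume] convOp k f - convOp l f := by
  filter_upwards [ae_integrable_sub_mul h hk hf, ae_integrable_sub_mul h hl hf] with x h1 h2
  simp only [Pi.sub_apply, convOp_apply, sub_mul]
  exact integral_sub h1 h2

theorem convOp_smul_right (k : 𝔼 → ℂ) (c : ℂ) (f : 𝔼 → ℂ) :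
    convOp k (c • f) = c • convOp k f := by
  ext x
  simp only [Pi.smul_apply, convOp_apply, smul_eq_mul, ← integral_const_mul]
  congr 1; ext y; ring

theorem convOp_shift (k : 𝔼 → ℂ) (a : 𝔼) (f : 𝔼 → ℂ) :
    convOp k (shift a f) = shift a (convOp k f) := by
  ext x
  simp only [shift, convOp_apply]
  rw [← integral_sub_right_eq_self (fun y => k (x - a - y) * f y) a]
  congr 1; ext y; congr 2; abel

theorem eLpNorm_shift (a : 𝔼) {f : 𝔼 → ℂ} (hf : AEStronglyMeasurable f volume) (P : ℝ≥0∞) :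
    eLpNorm (shift a f) P volume = eLpNorm f P volume :=
  eLpNorm_comp_measurePreserving hf (measurePreserving_sub_right volume a)

theorem memLp_shift (a : 𝔼) {f : 𝔼 → ℂ} {P : ℝ≥0∞} (hf : MemLp f P volume) :
    MemLp (shift a f) P volume :=
  hf.comp_measurePreserving (measurePreserving_sub_right volume a)

/-- Convolution with `k ∈ L_q` as a continuous linear map from `L_p` to `L_s`. -/
noncomputable def convCLM (h : YoungTriple p q s) [Fact (1 ≤ ENNReal.ofReal p)]
    [Fact (1 ≤ ENNReal.ofReal s)] {k : 𝔼 → ℂ} (hk : MemLp k (ENNReal.ofReal q) volume) :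
    Lp ℂ (ENNReal.ofReal p) (volume : Measure 𝔼) →L[ℂ]
      Lp ℂ (ENNReal.ofReal s) (volume : Measure 𝔼) :=
  LinearMap.mkContinuous
    { toFun := fun f => (memLp_convOp h hk (Lp.memLp f)).toLp _
      map_add' := fun f g => by
        rw [← MemLp.toLp_add, MemLp.toLp_eq_toLp_iff, convOp_congr_right k (Lp.coeFn_add f g)]
        exact convOp_add_right h hk (Lp.memLp f) (Lp.memLp g)
      map_smul' := fun c f => by
        rw [RingHom.id_apply, ← MemLp.toLp_const_smul, MemLp.toLp_eq_toLp_iff,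
          convOp_congr_right k (Lp.coeFn_smul c f), convOp_smul_right] }
    (eLpNorm k (ENNReal.ofReal q) volume).toReal fun f => by
      rw [LinearMap.coe_mk, AddHom.coe_mk, Lp.norm_toLp, Lp.norm_def, ← ENNReal.toReal_mul]
      exact ENNReal.toReal_mono (ENNReal.mul_ne_top hk.2.ne (Lp.memLp f).2.ne)
        (eLpNorm_convOp_le h hk.1 (Lp.memLp f).1)

theorem convCLM_toLp (h : YoungTriple p q s) [Fact (1 ≤ ENNReal.ofReal p)]
    [Fact (1 ≤ ENNReal.ofReal s)] {k f : 𝔼 → ℂ} (hk : MemLp k (ENNReal.ofReal q) volume)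
    (hf : MemLp f (ENNReal.ofReal p) volume) :
    convCLM h hk (hf.toLp f) = (memLp_convOp h hk hf).toLp _ := by
  change (memLp_convOp h hk (Lp.memLp (hf.toLp f))).toLp _ = _
  rw [MemLp.toLp_eq_toLp_iff, convOp_congr_right k hf.coeFn_toLp]

theorem isUnitLp_coeFn {f : Lp ℂ (ENNReal.ofReal p) (volume : Measure 𝔼)} (hf : ‖f‖ = 1) :
    IsUnitLp p f :=
  ⟨Lp.memLp f, by
    rw [← ENNReal.ofReal_toReal (Lp.eLpNorm_ne_top f), ← Lp.norm_def, hf, ENNReal.ofReal_one]⟩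

theorem eLpNorm_convOp_eq_enorm (h : YoungTriple p q s) [Fact (1 ≤ ENNReal.ofReal p)]
    [Fact (1 ≤ ENNReal.ofReal s)] {k f : 𝔼 → ℂ} (hk : MemLp k (ENNReal.ofReal q) volume)
    (hf : MemLp f (ENNReal.ofReal p) volume) :
    eLpNorm (convOp k f) (ENNReal.ofReal s) volume = ‖convCLM h hk (hf.toLp f)‖ₑ := by
  rw [convCLM_toLp, Lp.enorm_toLp]

theorem eLpNorm_convOp_le_opNorm (h : YoungTriple p q s) [Fact (1 ≤ ENNReal.ofReal p)]
    [Fact (1 ≤ ENNReal.ofReal s)] {k f : 𝔼 → ℂ} (hk : MemLp k (ENNReal.ofReal q) volume)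
    (hf : MemLp f (ENNReal.ofReal p) volume) :
    eLpNorm (convOp k f) (ENNReal.ofReal s) volume ≤
      ‖convCLM h hk‖ₑ * eLpNorm f (ENNReal.ofReal p) volume := by
  rw [eLpNorm_convOp_eq_enorm h hk hf, ← Lp.enorm_toLp hf]
  exact (convCLM h hk).le_opENorm _

/-- The norm of the convolution operator is the operator norm of the bundled operator. -/
theorem convNorm_eq_enorm {r : ℝ} (h : YoungTriple p q (Real.conjExponent r))
    [Fact (1 ≤ ENNReal.ofReal p)] [Fact (1 ≤ ENNReal.ofReal (Real.conjExponent r))]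
    {k : 𝔼 → ℂ} (hk : MemLp k (ENNReal.ofReal q) volume) :
    convNorm p r k = ‖convCLM h hk‖ₑ := by
  refine le_antisymm (iSup₂_le fun f hf => ?_) ?_
  · have h1 := eLpNorm_convOp_le_opNorm h hk hf.1
    rwa [hf.2, mul_one] at h1
  · rcases eq_or_ne (convNorm p r k) ⊤ with htop | htop
    · rw [htop]; exact le_top
    · rw [← ofReal_norm, ← ENNReal.ofReal_toReal htop]
      refine ENNReal.ofReal_le_ofReal
        (ContinuousLinearMap.opNorm_le_of_unit_norm ENNReal.toReal_nonneg fun f hf => ?_)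
      refine (ENNReal.ofReal_le_iff_le_toReal htop).1 ?_
      have h1 := eLpNorm_convOp_eq_enorm h hk (Lp.memLp f)
      rw [Lp.toLp_coeFn] at h1
      rw [ofReal_norm, ← h1]
      exact le_iSup₂ (f := fun (f : 𝔼 → ℂ) (_ : IsUnitLp p f) =>
        eLpNorm (convOp k f) (conjExp r) volume) (f : 𝔼 → ℂ) (isUnitLp_coeFn hf)

/-- Approximate identities recover `k` from the functions `k * f`, so the operator vanishes only
for a null kernel. -/
theorem convCLM_ne_zero (h : YoungTriple p q s) [Fact (1 ≤ ENNReal.ofReal p)]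
    [Fact (1 ≤ ENNReal.ofReal s)] {k : 𝔼 → ℂ} (hk : MemLp k (ENNReal.ofReal q) volume)
    (hk0 : ¬ k =ᵐ[volume] 0) : convCLM h hk ≠ 0 := by
  intro h0
  refine hk0 ?_
  let φ : ℕ → ContDiffBump (0 : 𝔼) := fun n =>
    { rIn := 1 / ((n : ℝ) + 1)
      rOut := 2 * (1 / ((n : ℝ) + 1))
      rIn_pos := Nat.one_div_pos_of_nat
      rIn_lt_rOut := by
        have : 0 < 1 / ((n : ℝ) + 1) := Nat.one_div_pos_of_nat
        linarith }
  have hφ : Tendsto (fun n => (φ n).rOut) atTop (𝓝 0) := by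
    simpa [φ] using (tendsto_one_div_add_atTop_nhds_zero_nat (𝕜 := ℝ)).const_mul 2
  have hlim := ContDiffBump.ae_convolution_tendsto_right_of_locallyIntegrable
    (μ := (volume : Measure 𝔼)) hφ (K := 2) (Eventually.of_forall fun n => le_rfl)
    (hk.locallyIntegrable (by simpa using h.one_lt_right.le))
  have hzero : ∀ n, convOp k (fun y => ((φ n).normed volume y : ℂ)) =ᵐ[volume] 0 := fun n => by
    have hm : MemLp (fun y => ((φ n).normed volume y : ℂ)) (ENNReal.ofReal p) volume := by
      refine Continuous.memLp_of_hasCompactSupport ?_ ?_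
      · exact Complex.continuous_ofReal.comp (φ n).continuous_normed
      · exact (φ n).hasCompactSupport_normed.comp_left Complex.ofReal_zero
    have h1 := eLpNorm_convOp_eq_enorm h hk hm
    rw [h0, zero_apply, enorm_zero,
      eLpNorm_eq_zero_iff (memLp_convOp h hk hm).1 (by simpa using h.pos)] at h1
    exact h1
  filter_upwards [hlim, ae_all_iff.2 hzero] with x hx h1
  refine tendsto_nhds_unique hx (tendsto_const_nhds.congr fun n => ?_)
  rw [← h1 n, convOp_apply, convolution_def]
  congr 1; ext y
  simp [mul_comm]

/-! ### Concentration of maximizing sequences -/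

theorem exists_forall_le_norm_eq_zero {k : 𝔼 → ℂ} (hk : HasCompactSupport k) :
    ∃ ρ : ℝ, 0 < ρ ∧ ∀ x, ρ ≤ ‖x‖ → k x = 0 := by
  obtain ⟨ρ, hρ0, hρ⟩ := hk.isCompact.isBounded.subset_ball_lt 0 0
  refine ⟨ρ, hρ0, fun x hx => image_eq_zero_of_notMem_tsupport fun hxs => ?_⟩
  have := hρ hxs
  rw [mem_ball_zero_iff] at this
  linarith

/-- Integration over balls of a fixed radius is convolution with the indicator of a ball. -/
theorem setLIntegral_ball_eq (g : 𝔼 → ℝ≥0∞) (z : 𝔼) (L : ℝ) :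
    ∫⁻ x in Metric.ball z L, g x =
      ∫⁻ x, (Metric.ball (0 : 𝔼) L).indicator 1 (z - x) * g x := by
  rw [← lintegral_indicator Metric.isOpen_ball.measurableSet]
  refine lintegral_congr fun x => ?_
  have hiff : z - x ∈ Metric.ball (0 : 𝔼) L ↔ x ∈ Metric.ball z L := by
    rw [mem_ball_zero_iff, ← dist_eq_norm, dist_comm, Metric.mem_ball]
  by_cases hx : x ∈ Metric.ball z L
  · simp [hx, hiff.2 hx]
  · simp [hx, mt hiff.1 hx]

theorem aemeasurable_setLIntegral_ball {g : 𝔼 → ℝ≥0∞} (hg : AEMeasurable g volume) (L : ℝ) :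
    AEMeasurable (fun z => ∫⁻ x in Metric.ball z L, g x) volume := by
  simp_rw [setLIntegral_ball_eq]
  exact AEMeasurable.lintegral_prod_right'
    (f := fun z : 𝔼 × 𝔼 => (Metric.ball (0 : 𝔼) L).indicator 1 (z.1 - z.2) * g z.2)
    ((aemeasurable_comp_sub
      (aemeasurable_one.indicator Metric.isOpen_ball.measurableSet)).mul hg.comp_snd)

theorem lintegral_setLIntegral_ball {g : 𝔼 → ℝ≥0∞} (hg : AEMeasurable g volume) (L : ℝ) :
    ∫⁻ z, ∫⁻ x in Metric.ball z L, g x = volume (Metric.ball (0 : 𝔼) L) * ∫⁻ x, g x := by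
  have hB : MeasurableSet (Metric.ball (0 : 𝔼) L) := Metric.isOpen_ball.measurableSet
  simp_rw [setLIntegral_ball_eq]
  rw [lintegral_lintegral_sub_mul (κ := (Metric.ball (0 : 𝔼) L).indicator 1)
    (aemeasurable_one.indicator hB) hg, lintegral_indicator_one hB]

theorem convOp_indicator_ball {k : 𝔼 → ℂ} {ρ : ℝ} (hk : ∀ x, ρ ≤ ‖x‖ → k x = 0) (f : 𝔼 → ℂ)
    {z x : 𝔼} {L : ℝ} (hx : x ∈ Metric.ball z L) :
    convOp k ((Metric.ball z (L + ρ)).indicator f) x = convOp k f x := by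
  simp_rw [convOp_apply]
  congr 1; ext y
  by_cases hy : y ∈ Metric.ball z (L + ρ)
  · rw [Set.indicator_of_mem hy]
  · rw [hk (x - y), zero_mul, zero_mul]
    rw [Metric.mem_ball] at hx hy
    have := dist_triangle y x z
    rw [← dist_eq_norm, dist_comm]
    linarith

/-- If the kernel is supported in a ball of radius `ρ` then `k * f` is controlled by the largest
mass of `f` on a ball of radius `L + ρ`. On `ball z L` the function `k * f` depends only on the
restriction of `f` to `ball z (L + ρ)`; since `p < s`, the resulting bound by the `s`-th power of
the mass there is at most `M ^ (s - p)` times its `p`-th power, and the latter is additive: the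
estimates can be integrated over all centers `z`. -/
theorem volume_ball_mul_eLpNorm_convOp_rpow_le (hp : 0 < p) (hps : p < s) {k : 𝔼 → ℂ}
    {ρ : ℝ} (hk : ∀ x, ρ ≤ ‖x‖ → k x = 0) {N : ℝ≥0∞}
    (hN : ∀ g : 𝔼 → ℂ, MemLp g (ENNReal.ofReal p) volume →
      eLpNorm (convOp k g) (ENNReal.ofReal s) volume ≤ N * eLpNorm g (ENNReal.ofReal p) volume)
    {f : 𝔼 → ℂ} (hf : MemLp f (ENNReal.ofReal p) volume)
    (hkf : AEStronglyMeasurable (convOp k f) volume) {L : ℝ} {M : ℝ≥0∞}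
    (hM : ∀ z, eLpNorm ((Metric.ball z (L + ρ)).indicator f) (ENNReal.ofReal p) volume ≤ M) :
    volume (Metric.ball (0 : 𝔼) L) * eLpNorm (convOp k f) (ENNReal.ofReal s) volume ^ s ≤
      N ^ s * M ^ (s - p) *
        (volume (Metric.ball (0 : 𝔼) (L + ρ)) * eLpNorm f (ENNReal.ofReal p) volume ^ p) := by
  have hs : 0 < s := hp.trans hps
  have hfm : AEMeasurable (fun x => ‖f x‖ₑ ^ p) volume := hf.1.enorm.pow_const p
  have hloc : ∀ z, ∫⁻ x in Metric.ball z L, ‖convOp k f x‖ₑ ^ s ≤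
      N ^ s * M ^ (s - p) * ∫⁻ x in Metric.ball z (L + ρ), ‖f x‖ₑ ^ p := fun z => by
    set g := (Metric.ball z (L + ρ)).indicator f with hg
    have hgp : MemLp g (ENNReal.ofReal p) volume := hf.indicator Metric.isOpen_ball.measurableSet
    have hgi : ∫⁻ x in Metric.ball z (L + ρ), ‖f x‖ₑ ^ p =
        eLpNorm g (ENNReal.ofReal p) volume ^ p := by
      rw [← eLpNorm_ofReal_rpow hp,
        ← eLpNorm_indicator_eq_eLpNorm_restrict Metric.isOpen_ball.measurableSet]
    calc ∫⁻ x in Metric.ball z L, ‖convOp k f x‖ₑ ^ s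
        = ∫⁻ x in Metric.ball z L, ‖convOp k g x‖ₑ ^ s :=
          setLIntegral_congr_fun Metric.isOpen_ball.measurableSet fun x hx => by
            simp only [hg, convOp_indicator_ball hk f hx]
      _ ≤ eLpNorm (convOp k g) (ENNReal.ofReal s) volume ^ s := by
          rw [eLpNorm_ofReal_rpow hs]; exact setLIntegral_le_lintegral _ _
      _ ≤ (N * eLpNorm g (ENNReal.ofReal p) volume) ^ s := ENNReal.rpow_le_rpow (hN g hgp) hs.le
      _ = N ^ s * (eLpNorm g (ENNReal.ofReal p) volume ^ (s - p) *
            eLpNorm g (ENNReal.ofReal p) volume ^ p) := by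
          rw [ENNReal.mul_rpow_of_nonneg _ _ hs.le,
            ← ENNReal.rpow_add_of_nonneg _ _ (sub_nonneg.2 hps.le) hp.le, sub_add_cancel]
      _ ≤ N ^ s * M ^ (s - p) * ∫⁻ x in Metric.ball z (L + ρ), ‖f x‖ₑ ^ p := by
          rw [hgi, ← mul_assoc]
          gcongr
          exact hM z
  rw [eLpNorm_ofReal_rpow hs, eLpNorm_ofReal_rpow hp,
    ← lintegral_setLIntegral_ball (hkf.enorm.pow_const s), ← lintegral_setLIntegral_ball hfm]
  refine (lintegral_mono hloc).trans_eq ?_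
  rw [lintegral_const_mul'' _ (aemeasurable_setLIntegral_ball hfm _)]

/-- The localized estimate for unit vectors, with the common volume of the unit ball cancelled. -/
theorem ofReal_pow_mul_eLpNorm_convOp_rpow_le (hp : 0 < p) (hps : p < s) {k : 𝔼 → ℂ}
    {ρ : ℝ} (hρ : 0 < ρ) (hk : ∀ x, ρ ≤ ‖x‖ → k x = 0) {N : ℝ≥0∞}
    (hN : ∀ g : 𝔼 → ℂ, MemLp g (ENNReal.ofReal p) volume →
      eLpNorm (convOp k g) (ENNReal.ofReal s) volume ≤ N * eLpNorm g (ENNReal.ofReal p) volume)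
    {f : 𝔼 → ℂ} (hf : IsUnitLp p f)
    (hkf : AEStronglyMeasurable (convOp k f) volume) {L : ℝ} (hL : 0 < L) {M : ℝ≥0∞}
    (hM : ∀ z, eLpNorm ((Metric.ball z (L + ρ)).indicator f) (ENNReal.ofReal p) volume ≤ M) :
    ENNReal.ofReal (L ^ d) * eLpNorm (convOp k f) (ENNReal.ofReal s) volume ^ s ≤
      N ^ s * M ^ (s - p) * ENNReal.ofReal ((L + ρ) ^ d) := by
  have h := volume_ball_mul_eLpNorm_convOp_rpow_le hp hps hk hN hf.1 hkf hM
  rw [Measure.addHaar_ball_of_pos _ _ hL, Measure.addHaar_ball_of_pos _ _ (add_pos hL hρ), hf.2,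
    ENNReal.one_rpow, mul_one, finrank_euclideanSpace_fin, mul_right_comm, ← mul_assoc] at h
  exact (ENNReal.mul_le_mul_iff_left (Metric.measure_ball_pos volume _ one_pos).ne'
    measure_ball_lt_top.ne).1 h

/-- Along a maximizing sequence, almost the full mass lies in balls of a fixed radius. -/
theorem exists_eventually_lt_eLpNorm_indicator_ball (h : YoungTriple p q s)
    [Fact (1 ≤ ENNReal.ofReal p)] [Fact (1 ≤ ENNReal.ofReal s)] {k : 𝔼 → ℂ}
    (hk : MemLp k (ENNReal.ofReal q) volume) (hT : convCLM h hk ≠ 0)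
    {f : ℕ → 𝔼 → ℂ} (hf : ∀ n, IsUnitLp p (f n))
    (hlim : Tendsto (fun n => eLpNorm (convOp k (f n)) (ENNReal.ofReal s) volume) atTop
      (𝓝 ‖convCLM h hk‖ₑ)) {θ : ℝ} (hθ0 : 0 ≤ θ) (hθ : θ < 1) :
    ∃ R, ∀ᶠ n in atTop, ∃ z,
      ENNReal.ofReal θ <
        eLpNorm ((Metric.ball z R).indicator (f n)) (ENNReal.ofReal p) volume := by
  have hp := h.left_pos
  have hs := h.pos
  have hsp : 0 < s - p := sub_pos.2 h.left_lt
  set N := ‖convCLM h hk‖ with hNdef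
  have hN : 0 < N := norm_pos_iff.2 hT
  have ht1 : θ ^ (s - p) < 1 := Real.rpow_lt_one hθ0 hθ hsp
  -- `N - 2 * ε` and `N + ε` will bound the relevant norms for a kernel `ε`-close to `k`
  obtain ⟨ε, hε, hεN, hεt⟩ : ∃ ε : ℝ, 0 < ε ∧ 2 * ε < N ∧
      θ ^ (s - p) < ((N - 2 * ε) / (N + ε)) ^ s := by
    have hc : ContinuousAt (fun ε : ℝ => ((N - 2 * ε) / (N + ε)) ^ s) 0 := by
      refine ContinuousAt.rpow_const (ContinuousAt.div (by fun_prop) (by fun_prop) ?_)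
        (Or.inr hs.le)
      simpa using hN.ne'
    have h1 : Tendsto (fun ε : ℝ => ((N - 2 * ε) / (N + ε)) ^ s) (𝓝 0) (𝓝 1) := by
      have := hc.tendsto
      simpa [div_self hN.ne'] using this
    have h2 : Tendsto (fun ε : ℝ => 2 * ε) (𝓝 0) (𝓝 0) := by
      simpa using (continuous_const_mul (2 : ℝ)).tendsto 0
    have h3 : ∀ᶠ ε : ℝ in 𝓝[>] 0, 2 * ε < N ∧ θ ^ (s - p) < ((N - 2 * ε) / (N + ε)) ^ s :=
      nhdsWithin_le_nhds ((h2.eventually_lt_const hN).and (h1.eventually_const_lt ht1))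
    obtain ⟨ε, h, h'⟩ := (h3.and self_mem_nhdsWithin).exists
    exact ⟨ε, h', h⟩
  obtain ⟨k', hk'c, hkk', -, hk'⟩ := hk.exists_hasCompactSupport_eLpNorm_sub_le
    ENNReal.ofReal_ne_top (ε := ENNReal.ofReal ε) (by simpa using hε)
  obtain ⟨ρ, hρ, hρk⟩ := exists_forall_le_norm_eq_zero hk'c
  obtain ⟨L, hL, hLt⟩ : ∃ L : ℝ, 0 < L ∧
      θ ^ (s - p) < (L / (L + ρ)) ^ d * ((N - 2 * ε) / (N + ε)) ^ s := by
    have h1 : Tendsto (fun L : ℝ => L / (L + ρ)) atTop (𝓝 1) := by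
      have h2 : Tendsto (fun L : ℝ => 1 - ρ / (L + ρ)) atTop (𝓝 (1 - 0)) :=
        tendsto_const_nhds.sub
          (tendsto_const_nhds.div_atTop (tendsto_atTop_add_const_right _ _ tendsto_id))
      rw [sub_zero] at h2
      refine h2.congr' ?_
      filter_upwards [eventually_gt_atTop 0] with L hL
      field_simp
      simp
    have h3 := (h1.pow d).mul_const (((N - 2 * ε) / (N + ε)) ^ s)
    rw [one_pow, one_mul] at h3
    obtain ⟨L, hL1, hL2⟩ := ((h3.eventually_const_lt hεt).and (eventually_gt_atTop 0)).exists
    exact ⟨L, hL2, hL1⟩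
  have hTN : ‖convCLM h hk‖ₑ = ENNReal.ofReal N := (ofReal_norm _).symm
  have hdiff : ∀ g : 𝔼 → ℂ, MemLp g (ENNReal.ofReal p) volume →
      eLpNorm (convOp k g - convOp k' g) (ENNReal.ofReal s) volume ≤
        ENNReal.ofReal ε * eLpNorm g (ENNReal.ofReal p) volume := fun g hg => by
    rw [← eLpNorm_congr_ae (convOp_sub_left h hk hk' hg)]
    exact (eLpNorm_convOp_le h (hk.sub hk').1 hg.1).trans (by gcongr)
  have hN' : ∀ g : 𝔼 → ℂ, MemLp g (ENNReal.ofReal p) volume →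
      eLpNorm (convOp k' g) (ENNReal.ofReal s) volume ≤
        ENNReal.ofReal (N + ε) * eLpNorm g (ENNReal.ofReal p) volume := fun g hg => by
    have h1 : convOp k' g = convOp k g - (convOp k g - convOp k' g) := by abel
    rw [h1, ENNReal.ofReal_add hN.le hε.le, add_mul, ← hTN]
    have hm := memLp_convOp h hk hg
    exact (eLpNorm_sub_le hm.1 (hm.sub (memLp_convOp h hk' hg)).1 h.fact_out.out).trans
      (add_le_add (eLpNorm_convOp_le_opNorm h hk hg) (hdiff g hg))
  refine ⟨L + ρ, ?_⟩
  have hlt : ENNReal.ofReal (N - ε) < ‖convCLM h hk‖ₑ := by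
    rw [hTN]; exact (ENNReal.ofReal_lt_ofReal_iff hN).2 (by linarith)
  filter_upwards [hlim.eventually_const_lt hlt] with n hn
  have hlow : ENNReal.ofReal (N - 2 * ε) ≤
      eLpNorm (convOp k' (f n)) (ENNReal.ofReal s) volume := by
    have h1 : convOp k (f n) = convOp k' (f n) + (convOp k (f n) - convOp k' (f n)) := by abel
    have hm := memLp_convOp h hk (hf n).1
    have hm' := memLp_convOp h hk' (hf n).1
    have h2 := eLpNorm_add_le hm'.1 (hm.sub hm').1 h.fact_out.out
    rw [← h1] at h2
    have h3 := hdiff _ (hf n).1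
    rw [(hf n).2, mul_one] at h3
    have h4 := hn.le.trans (h2.trans (add_le_add le_rfl h3))
    rw [← tsub_le_iff_right, ← ENNReal.ofReal_sub _ hε.le] at h4
    rwa [show N - ε - ε = N - 2 * ε by ring] at h4
  by_contra! hM
  have hkey := ofReal_pow_mul_eLpNorm_convOp_rpow_le hp h.left_lt hρ hρk hN' (hf n)
    (memLp_convOp h hk' (hf n).1).1 hL hM
  have hkey2 := (mul_le_mul_right (ENNReal.rpow_le_rpow hlow hs.le) _).trans hkey
  have hNε : 0 < N - 2 * ε := by linarith
  have hNε' : 0 < N + ε := by linarith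
  rw [ENNReal.ofReal_rpow_of_nonneg hNε.le hs.le, ENNReal.ofReal_rpow_of_nonneg hNε'.le hs.le,
    ENNReal.ofReal_rpow_of_nonneg hθ0 hsp.le, ← ENNReal.ofReal_mul (by positivity),
    ← ENNReal.ofReal_mul (by positivity), ← ENNReal.ofReal_mul (by positivity),
    ENNReal.ofReal_le_ofReal_iff (by positivity)] at hkey2
  rw [div_pow, Real.div_rpow hNε.le hNε'.le, div_mul_div_comm,
    lt_div_iff₀ (by positivity)] at hLt
  linarith

/-- A maximizing sequence is tight up to translations. -/
theorem exists_shift_tight (h : YoungTriple p q s)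
    [Fact (1 ≤ ENNReal.ofReal p)] [Fact (1 ≤ ENNReal.ofReal s)] {k : 𝔼 → ℂ}
    (hk : MemLp k (ENNReal.ofReal q) volume) (hT : convCLM h hk ≠ 0)
    {f : ℕ → 𝔼 → ℂ} (hf : ∀ n, IsUnitLp p (f n))
    (hlim : Tendsto (fun n => eLpNorm (convOp k (f n)) (ENNReal.ofReal s) volume) atTop
      (𝓝 ‖convCLM h hk‖ₑ)) :
    ∃ a : ℕ → 𝔼, ∀ η : ℝ≥0∞, 0 < η → ∃ R, ∀ n,
      eLpNorm ((Metric.ball (0 : 𝔼) R)ᶜ.indicator (shift (a n) (f n)))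
        (ENNReal.ofReal p) volume ≤ η := by
  have hp := h.left_pos
  -- the probability measures with densities `|f n| ^ p`
  set ν : ℕ → Measure 𝔼 := fun n => volume.withDensity fun x => ‖f n x‖ₑ ^ p with hν
  have hνA : ∀ n (A : Set 𝔼), MeasurableSet A →
      ν n A = eLpNorm (A.indicator (f n)) (ENNReal.ofReal p) volume ^ p := fun n A hA => by
    rw [hν, withDensity_apply _ hA, eLpNorm_indicator_eq_eLpNorm_restrict hA,
      eLpNorm_ofReal_rpow hp]
  have hprob : ∀ n, IsProbabilityMeasure (ν n) := fun n =>
    ⟨by rw [hνA n _ MeasurableSet.univ, Set.indicator_univ, (hf n).2, ENNReal.one_rpow]⟩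
  obtain ⟨a, ha⟩ := exists_tight_centers ν fun θ hθ => by
    have hθr : θ.toReal ^ p⁻¹ < 1 :=
      Real.rpow_lt_one ENNReal.toReal_nonneg
        (by simpa using (ENNReal.toReal_lt_toReal hθ.ne_top ENNReal.one_ne_top).2 hθ)
        (inv_pos.2 hp)
    obtain ⟨R, hR⟩ := exists_eventually_lt_eLpNorm_indicator_ball h hk hT hf hlim
      (Real.rpow_nonneg ENNReal.toReal_nonneg _) hθr
    refine ⟨R, hR.mono fun n ⟨z, hz⟩ => ⟨z, ?_⟩⟩
    rw [hνA n _ Metric.isOpen_ball.measurableSet]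
    rw [← ENNReal.ofReal_rpow_of_nonneg ENNReal.toReal_nonneg (inv_nonneg.2 hp.le),
      ENNReal.ofReal_toReal hθ.ne_top] at hz
    have := ENNReal.rpow_lt_rpow hz hp
    rwa [ENNReal.rpow_inv_rpow hp.ne'] at this
  refine ⟨fun n => -a n, fun η hη => ?_⟩
  obtain ⟨R, hR⟩ := ha (η ^ p) (ENNReal.rpow_pos_of_nonneg hη hp.le)
  refine ⟨R, fun n => ?_⟩
  have hset : MeasurableSet (Metric.ball (a n) R)ᶜ := Metric.isOpen_ball.measurableSet.compl
  have h1 := hR n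
  rw [hνA n _ hset, ENNReal.rpow_le_rpow_iff hp] at h1
  have h2 : (Metric.ball (0 : 𝔼) R)ᶜ.indicator (shift (-a n) (f n)) =
      shift (-a n) ((Metric.ball (a n) R)ᶜ.indicator (f n)) := by
    ext x
    simp only [shift, Set.indicator, Set.mem_compl_iff, Metric.mem_ball,
      dist_eq_norm, sub_zero, sub_neg_eq_add, add_sub_cancel_right]
  rw [h2, eLpNorm_shift _ ((hf n).1.1.indicator hset)]
  exact h1

/-! ### Total boundedness and convergence -/

/-- The unit ball of `L_p` restricts to a bounded subset of `L_1` of a ball. -/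
theorem exists_integral_norm_indicator_ball_le (hp : 1 ≤ p) (R : ℝ) :
    ∃ A : ℝ, 0 ≤ A ∧ ∀ g : 𝔼 → ℂ, MemLp g (ENNReal.ofReal p) volume →
      eLpNorm g (ENNReal.ofReal p) volume ≤ 1 →
      Integrable ((Metric.ball 0 R).indicator g) volume ∧
        ∫ x, ‖(Metric.ball 0 R).indicator g x‖ ≤ A := by
  set B := Metric.ball (0 : 𝔼) R with hB
  have hBm : MeasurableSet B := Metric.isOpen_ball.measurableSet
  have hBfin : volume B < ⊤ := measure_ball_lt_top
  have : IsFiniteMeasure (volume.restrict B) := ⟨by rwa [Measure.restrict_apply_univ]⟩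
  have hp1 : (1 : ℝ≥0∞) ≤ ENNReal.ofReal p := by simpa using hp
  set V : ℝ≥0∞ := volume B ^ (1 / (1 : ℝ≥0∞).toReal - 1 / (ENNReal.ofReal p).toReal) with hV
  have hVfin : V ≠ ⊤ := by
    refine ENNReal.rpow_ne_top_of_nonneg ?_ hBfin.ne
    rw [ENNReal.toReal_ofReal (by linarith), ENNReal.toReal_one, div_one, sub_nonneg,
      div_le_one (by linarith)]
    exact hp
  refine ⟨V.toReal, ENNReal.toReal_nonneg, fun g hg hg1 => ?_⟩
  have hgi : Integrable (B.indicator g) volume := by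
    rw [integrable_indicator_iff hBm]
    exact memLp_one_iff_integrable.1 ((hg.restrict B).mono_exponent hp1)
  refine ⟨hgi, ?_⟩
  rw [integral_norm_eq_lintegral_enorm hgi.1, ← eLpNorm_one_eq_lintegral_enorm,
    eLpNorm_indicator_eq_eLpNorm_restrict hBm]
  refine ENNReal.toReal_mono hVfin
    ((eLpNorm_le_eLpNorm_mul_rpow_measure_univ hp1 (hg.restrict B).1).trans ?_)
  rw [Measure.restrict_apply_univ]
  calc _ ≤ 1 * V := by
        gcongr
        exact (eLpNorm_mono_measure _ Measure.restrict_le_self).trans hg1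
    _ = V := one_mul V

/-- Convolution with a continuous compactly supported kernel, applied to functions restricted to
a fixed ball, is a compact operator from `L_p` to `L_s`. -/
theorem exists_finite_net_convOp_indicator {ι : Type*} (hp : 1 ≤ p)
    {k : 𝔼 → ℂ} (hkc : HasCompactSupport k) (hkcont : Continuous k) (R : ℝ) {f : ι → 𝔼 → ℂ}
    (hf : ∀ i, MemLp (f i) (ENNReal.ofReal p) volume)
    (hf1 : ∀ i, eLpNorm (f i) (ENNReal.ofReal p) volume ≤ 1) {η : ℝ} (hη : 0 < η) :
    ∃ t : Set ι, t.Finite ∧ ∀ i, ∃ j ∈ t,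
      eLpNorm (convOp k ((Metric.ball 0 R).indicator (f i)) -
        convOp k ((Metric.ball 0 R).indicator (f j))) (ENNReal.ofReal s) volume ≤
          ENNReal.ofReal η := by
  set B := Metric.ball (0 : 𝔼) R with hB
  obtain ⟨A, hA0, hA⟩ := exists_integral_norm_indicator_ball_le (d := d) hp R
  obtain ⟨ρ, hρ, hρk⟩ := exists_forall_le_norm_eq_zero hkc
  obtain ⟨C, hC⟩ := hkcont.bounded_above_of_compact_support hkc
  set D := Metric.closedBall (0 : 𝔼) (R + ρ) with hD
  set u : ι → 𝔼 → ℂ := fun i => convOp k (B.indicator (f i)) with hu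
  have hux : ∀ i x, u i x = ∫ y, k (x - y) * B.indicator (f i) y := fun i x =>
    convOp_apply _ _ _
  have hint : ∀ i x, Integrable (fun y => k (x - y) * B.indicator (f i) y) := fun i x =>
    (hA _ (hf i) (hf1 i)).1.bdd_mul
      (hkcont.comp (continuous_const.sub continuous_id)).aestronglyMeasurable
      (Eventually.of_forall fun y => hC (x - y))
  have hbound : ∀ (w : 𝔼 → ℂ) (c : ℝ), 0 ≤ c → (∀ y, ‖w y‖ ≤ c) → ∀ i,
      ‖∫ y, w y * B.indicator (f i) y‖ ≤ c * A := fun w c hc hw i => by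
    refine (norm_integral_le_of_norm_le ((hA _ (hf i) (hf1 i)).1.norm.const_mul c)
      (Eventually.of_forall fun y => ?_)).trans ?_
    · rw [norm_mul]
      exact mul_le_mul_of_nonneg_right (hw y) (norm_nonneg _)
    · rw [integral_const_mul]
      exact mul_le_mul_of_nonneg_left (hA _ (hf i) (hf1 i)).2 hc
  have hzero : ∀ i, ∀ x ∉ D, u i x = 0 := fun i x hx => by
    rw [hux]
    refine integral_eq_zero_of_ae (Eventually.of_forall fun y => ?_)
    by_cases hy : y ∈ B
    · have hk0 : k (x - y) = 0 := by
        rw [hB, mem_ball_zero_iff] at hy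
        rw [hD, mem_closedBall_zero_iff, not_le] at hx
        exact hρk _ (by linarith [norm_sub_norm_le x y])
      simp [hk0]
    · simp [hy]
  have hequi : ∀ ω > 0, ∃ δ > 0, ∀ i x x', dist x x' < δ → ‖u i x - u i x'‖ ≤ ω :=
    fun ω hω => by
    obtain ⟨δ, hδ, hδk⟩ := Metric.uniformContinuous_iff.1
      (hkc.uniformContinuous_of_continuous hkcont) (ω / (A + 1)) (by positivity)
    refine ⟨δ, hδ, fun i x x' hxx => ?_⟩
    rw [hux, hux, ← integral_sub (hint i x) (hint i x')]
    simp_rw [← sub_mul]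
    refine (hbound (fun y => k (x - y) - k (x' - y)) (ω / (A + 1)) (by positivity)
      (fun y => ?_) i).trans ?_
    · rw [← dist_eq_norm]
      exact (hδk (by rwa [dist_sub_right])).le
    · rw [div_mul_eq_mul_div, div_le_iff₀ (by positivity)]
      nlinarith
  have hbdd : ∀ i x, ‖u i x‖ ≤ C * A := fun i x => by
    rw [hux]
    exact hbound _ C ((norm_nonneg _).trans (hC 0)) (fun y => hC (x - y)) i
  set V : ℝ≥0∞ := volume D ^ (ENNReal.ofReal s).toReal⁻¹ with hV
  have hVfin : V ≠ ⊤ :=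
    ENNReal.rpow_ne_top_of_nonneg (inv_nonneg.2 ENNReal.toReal_nonneg)
      measure_closedBall_lt_top.ne
  have hV0 : 0 ≤ V.toReal := ENNReal.toReal_nonneg
  obtain ⟨t, ht, htu⟩ := exists_finite_net_of_equicontinuous (isCompact_closedBall _ _) hzero
    hequi hbdd (η := η / (V.toReal + 1)) (by positivity)
  refine ⟨t, ht, fun i => ?_⟩
  obtain ⟨j, hj, hij⟩ := htu i
  refine ⟨j, hj, ?_⟩
  have hind : D.indicator (u i - u j) = u i - u j := by
    rw [Set.indicator_eq_self]
    intro x hx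
    by_contra hxD
    exact hx (by simp [hzero i x hxD, hzero j x hxD])
  -- the difference vanishes off `D`, so its `L_s` norm is controlled by the supremum norm
  change eLpNorm (u i - u j) _ _ ≤ _
  rw [← hind, eLpNorm_indicator_eq_eLpNorm_restrict Metric.isClosed_closedBall.measurableSet]
  refine (eLpNorm_le_of_ae_bound (Eventually.of_forall hij)).trans ?_
  rw [Measure.restrict_apply_univ, ← hV, ← ENNReal.ofReal_toReal hVfin,
    ← ENNReal.ofReal_mul hV0]
  refine ENNReal.ofReal_le_ofReal ?_
  rw [ENNReal.toReal_ofReal hV0, mul_div_assoc', div_le_iff₀ (by positivity)]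
  nlinarith

theorem norm_convCLM_sub_le (h : YoungTriple p q s) [Fact (1 ≤ ENNReal.ofReal p)]
    [Fact (1 ≤ ENNReal.ofReal s)] {k l : 𝔼 → ℂ} (hk : MemLp k (ENNReal.ofReal q) volume)
    (hl : MemLp l (ENNReal.ofReal q) volume) {g : 𝔼 → ℂ}
    (hg : MemLp g (ENNReal.ofReal p) volume) :
    ‖convCLM h hk (hg.toLp g) - convCLM h hl (hg.toLp g)‖ ≤
      (eLpNorm (k - l) (ENNReal.ofReal q) volume).toReal * ‖hg.toLp g‖ := by
  rw [convCLM_toLp, convCLM_toLp, ← MemLp.toLp_sub, Lp.norm_toLp, Lp.norm_toLp,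
    ← ENNReal.toReal_mul, ← eLpNorm_congr_ae (convOp_sub_left h hk hl hg)]
  exact ENNReal.toReal_mono (ENNReal.mul_ne_top (hk.sub hl).2.ne hg.2.ne)
    (eLpNorm_convOp_le h (hk.sub hl).1 hg.1)

/-- A bounded tight family in `L_p` has a totally bounded image under convolution with `k`. -/
theorem totallyBounded_range_convCLM (h : YoungTriple p q s) [Fact (1 ≤ ENNReal.ofReal p)]
    [Fact (1 ≤ ENNReal.ofReal s)] {k : 𝔼 → ℂ} (hk : MemLp k (ENNReal.ofReal q) volume)
    {ι : Type*} {f : ι → 𝔼 → ℂ} (hf : ∀ i, MemLp (f i) (ENNReal.ofReal p) volume)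
    (hf1 : ∀ i, eLpNorm (f i) (ENNReal.ofReal p) volume ≤ 1)
    (htight : ∀ η : ℝ≥0∞, 0 < η → ∃ R, ∀ i,
      eLpNorm ((Metric.ball (0 : 𝔼) R)ᶜ.indicator (f i)) (ENNReal.ofReal p) volume ≤ η) :
    TotallyBounded (Set.range fun i => convCLM h hk ((hf i).toLp (f i))) := by
  refine Metric.totallyBounded_iff.2 fun ε hε => ?_
  set T := convCLM h hk with hT
  -- mass `η` outside the ball changes the image by at most `‖T‖ * η ≤ ε / 8`
  set η : ℝ := ε / (8 * (‖T‖ + 1)) with hη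
  have hη0 : 0 < η := by positivity
  obtain ⟨R, hR⟩ := htight (ENNReal.ofReal η) (by simpa using hη0)
  obtain ⟨k', hk'c, hkk', hk'cont, hk'⟩ := hk.exists_hasCompactSupport_eLpNorm_sub_le
    ENNReal.ofReal_ne_top (ε := ENNReal.ofReal (ε / 8)) (by simpa using hε)
  obtain ⟨t, ht, htf⟩ := exists_finite_net_convOp_indicator h.one_lt_left.le hk'c hk'cont R
    hf hf1 (η := ε / 4) (by positivity)
  have hBm : MeasurableSet (Metric.ball (0 : 𝔼) R) := Metric.isOpen_ball.measurableSet
  have hg : ∀ i, MemLp ((Metric.ball 0 R).indicator (f i)) (ENNReal.ofReal p) volume :=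
    fun i => (hf i).indicator hBm
  set T' := convCLM h hk' with hT'
  have hgn : ∀ i, ‖(hg i).toLp _‖ ≤ 1 := fun i => by
    rw [Lp.norm_toLp]
    exact ENNReal.toReal_le_of_le_ofReal zero_le_one
      (((eLpNorm_indicator_le _).trans (hf1 i)).trans_eq ENNReal.ofReal_one.symm)
  have happrox : ∀ i, ‖T ((hf i).toLp _) - T' ((hg i).toLp _)‖ ≤ ε / 4 := fun i => by
    have h1 : T ((hf i).toLp _) - T' ((hg i).toLp _) =
        T ((hf i).toLp _ - (hg i).toLp _) + (T ((hg i).toLp _) - T' ((hg i).toLp _)) := by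
      rw [map_sub]; abel
    have h2 : ‖(hf i).toLp _ - (hg i).toLp _‖ ≤ η := by
      rw [← MemLp.toLp_sub, Lp.norm_toLp]
      refine ENNReal.toReal_le_of_le_ofReal hη0.le ?_
      rw [← Set.indicator_compl]
      exact hR i
    have h3 : ‖T ((hf i).toLp _ - (hg i).toLp _)‖ ≤ ε / 8 := by
      refine (T.le_opNorm_of_le h2).trans ?_
      rw [hη, mul_div_assoc', div_le_div_iff₀ (by positivity) (by positivity)]
      nlinarith [norm_nonneg T]
    have h4 : ‖T ((hg i).toLp _) - T' ((hg i).toLp _)‖ ≤ ε / 8 := by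
      refine (norm_convCLM_sub_le h hk hk' (hg i)).trans ?_
      have h5 : (eLpNorm (k - k') (ENNReal.ofReal q) volume).toReal ≤ ε / 8 :=
        ENNReal.toReal_le_of_le_ofReal (by positivity) hkk'
      calc _ ≤ ε / 8 * 1 := mul_le_mul h5 (hgn i) (norm_nonneg _) (by positivity)
        _ = ε / 8 := mul_one _
    rw [h1]
    linarith [norm_add_le (T ((hf i).toLp _ - (hg i).toLp _))
      (T ((hg i).toLp _) - T' ((hg i).toLp _))]
  refine ⟨(fun i => T ((hf i).toLp (f i))) '' t, ht.image _, ?_⟩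
  rintro _ ⟨i, rfl⟩
  obtain ⟨j, hj, hij⟩ := htf i
  refine Set.mem_iUnion₂.2 ⟨_, ⟨j, hj, rfl⟩, ?_⟩
  have h1 : ‖T' ((hg i).toLp _) - T' ((hg j).toLp _)‖ ≤ ε / 4 := by
    rw [hT', convCLM_toLp, convCLM_toLp, ← MemLp.toLp_sub, Lp.norm_toLp]
    exact ENNReal.toReal_le_of_le_ofReal (by positivity) hij
  rw [Metric.mem_ball]
  have h2 := dist_triangle4 (T ((hf i).toLp (f i))) (T' ((hg i).toLp _)) (T' ((hg j).toLp _))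
    (T ((hf j).toLp (f j)))
  have h3 := happrox j
  rw [← dist_eq_norm] at h1 h3
  rw [dist_comm] at h3
  have h4 := happrox i
  rw [← dist_eq_norm] at h4
  linarith

/-- A tight maximizing sequence has a convergent subsequence. -/
theorem exists_subseq_tendstoLp (h : YoungTriple p q s)
    [Fact (1 ≤ ENNReal.ofReal p)] [Fact (1 ≤ ENNReal.ofReal s)] {k : 𝔼 → ℂ}
    (hk : MemLp k (ENNReal.ofReal q) volume) (hT : convCLM h hk ≠ 0)
    {f : ℕ → 𝔼 → ℂ} (hf : ∀ n, IsUnitLp p (f n))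
    (hlim : Tendsto (fun n => eLpNorm (convOp k (f n)) (ENNReal.ofReal s) volume) atTop
      (𝓝 ‖convCLM h hk‖ₑ))
    (htight : ∀ η : ℝ≥0∞, 0 < η → ∃ R, ∀ n,
      eLpNorm ((Metric.ball (0 : 𝔼) R)ᶜ.indicator (f n)) (ENNReal.ofReal p) volume ≤ η) :
    ∃ φ : ℕ → ℕ, StrictMono φ ∧ ∃ g : 𝔼 → ℂ, TendstoLp p (fun j => f (φ j)) g := by
  have := uniformConvexSpace_Lp (E := ℂ) (μ := (volume : Measure 𝔼)) h.one_lt_left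
  have htb := totallyBounded_range_convCLM h hk (fun n => (hf n).1) (fun n => (hf n).2.le) htight
  obtain ⟨y, -, φ, hφ, hy⟩ := (htb.closure.isCompact_of_isClosed isClosed_closure).tendsto_subseq
    (fun n => subset_closure ⟨n, rfl⟩)
  have hlim' : Tendsto (fun j => ‖convCLM h hk ((hf (φ j)).1.toLp _)‖) atTop
      (𝓝 ‖convCLM h hk‖) := by
    have h1 := (ENNReal.tendsto_toReal enorm_ne_top).comp (hlim.comp hφ.tendsto_atTop)
    rw [toReal_enorm] at h1
    refine h1.congr fun j => ?_
    simp only [Function.comp_apply]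
    rw [eLpNorm_convOp_eq_enorm h hk (hf (φ j)).1, toReal_enorm]
  have hc : CauchySeq fun j => (hf (φ j)).1.toLp (f (φ j)) :=
    cauchySeq_of_norm_tendsto_opNorm (convCLM h hk) hT
      (fun j => by rw [Lp.norm_toLp, (hf (φ j)).2, ENNReal.toReal_one]) hlim' hy.cauchySeq
  obtain ⟨G, hG⟩ := cauchySeq_tendsto_of_complete hc
  refine ⟨φ, hφ, G, Lp.memLp G, ?_⟩
  rw [← Lp.tendsto_Lp_iff_tendsto_eLpNorm'' _ (fun j => (hf (φ j)).1) _ (Lp.memLp G),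
    Lp.toLp_coeFn]
  exact hG

theorem isUnitLp_shift {f : 𝔼 → ℂ} (hf : IsUnitLp p f) (a : 𝔼) : IsUnitLp p (shift a f) :=
  ⟨memLp_shift a hf.1, by rw [eLpNorm_shift a hf.1.1, hf.2]⟩

theorem eLpNorm_convOp_shift (h : YoungTriple p q s) {k f : 𝔼 → ℂ}
    (hk : MemLp k (ENNReal.ofReal q) volume) (hf : MemLp f (ENNReal.ofReal p) volume) (a : 𝔼) :
    eLpNorm (convOp k (shift a f)) (ENNReal.ofReal s) volume =
      eLpNorm (convOp k f) (ENNReal.ofReal s) volume := by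
  rw [convOp_shift, eLpNorm_shift a (memLp_convOp h hk hf).1]

/-- Norm one and convergence of `‖k * f n‖_s` pass to limits in `L_p`. -/
theorem unit_and_norm_of_tendstoLp (h : YoungTriple p q s)
    [Fact (1 ≤ ENNReal.ofReal p)] [Fact (1 ≤ ENNReal.ofReal s)] {k : 𝔼 → ℂ}
    (hk : MemLp k (ENNReal.ofReal q) volume) {f : ℕ → 𝔼 → ℂ} (hf : ∀ n, IsUnitLp p (f n))
    {N : ℝ≥0∞}
    (hlim : Tendsto (fun n => eLpNorm (convOp k (f n)) (ENNReal.ofReal s) volume) atTop (𝓝 N))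
    {g : 𝔼 → ℂ} (hg : TendstoLp p f g) :
    IsUnitLp p g ∧ eLpNorm (convOp k g) (ENNReal.ofReal s) volume = N := by
  have hG := (Lp.tendsto_Lp_iff_tendsto_eLpNorm'' f (fun n => (hf n).1) g hg.1).2 hg.2
  constructor
  · refine ⟨hg.1, ?_⟩
    have h1 := hG.enorm
    simp only [Lp.enorm_toLp, (hf _).2] at h1
    exact tendsto_nhds_unique h1 tendsto_const_nhds
  · have h1 := (((convCLM h hk).continuous.tendsto _).comp hG).enorm
    simp only [Function.comp_apply, ← eLpNorm_convOp_eq_enorm] at h1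
    exact tendsto_nhds_unique h1 hlim

end Convolution

end ConvMax

theorem proposition5p6 (d : ℕ) (p q r : ℝ) (hp : 1 < p) (hq : 1 < q) (hr : 1 < r)
    (hpqr : 1 / p + 1 / q + 1 / r = 2)
    (k : EuclideanSpace ℝ (Fin d) → ℂ) (hk : MemLp k (ENNReal.ofReal q) volume)
    (hk0 : ¬ k =ᵐ[volume] 0)
    (f : ℕ → EuclideanSpace ℝ (Fin d) → ℂ) (hf : ConvMax.IsMaximizingSeq p r k f) :
    -- a subsequence converges in `L_p` after suitable translations
    (∃ φ : ℕ → ℕ, StrictMono φ ∧ ∃ (a : ℕ → EuclideanSpace ℝ (Fin d))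
      (g : EuclideanSpace ℝ (Fin d) → ℂ),
      ConvMax.TendstoLp p (fun j => ConvMax.shift (a j) (f (φ j))) g) ∧
    -- every limit obtained in this way is a maximizer
    (∀ φ : ℕ → ℕ, StrictMono φ → ∀ (a : ℕ → EuclideanSpace ℝ (Fin d))
      (g : EuclideanSpace ℝ (Fin d) → ℂ),
      ConvMax.TendstoLp p (fun j => ConvMax.shift (a j) (f (φ j))) g →
        ConvMax.IsMaximizer p r k g) ∧
    -- the sequence is shift-compact
    ConvMax.IsShiftCompact p f := by
  have h := ConvMax.youngTriple_conjExponent hp hq hr hpqr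
  have := h.fact_left
  have := h.fact_out
  have hT := ConvMax.convCLM_ne_zero h hk hk0
  obtain ⟨hunit, hlim⟩ := hf
  have hcompact : ConvMax.IsShiftCompact p f := by
    rw [ConvMax.convNorm_eq_enorm h hk] at hlim
    obtain ⟨a, ha⟩ := ConvMax.exists_shift_tight h hk hT hunit hlim
    refine ⟨a, fun ψ hψ => ?_⟩
    refine ConvMax.exists_subseq_tendstoLp h hk hT
      (f := fun j => ConvMax.shift (a (ψ j)) (f (ψ j)))
      (fun j => ConvMax.isUnitLp_shift (hunit _) _) ?_ fun η hη => (ha η hη).imp fun R hR j => hR _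
    refine (hlim.comp hψ.tendsto_atTop).congr fun j => ?_
    exact (ConvMax.eLpNorm_convOp_shift h hk (hunit _).1 _).symm
  refine ⟨?_, fun φ hφ a g hg => ?_, hcompact⟩
  · obtain ⟨a, ha⟩ := hcompact
    obtain ⟨φ, hφ, g, hg⟩ := ha id strictMono_id
    exact ⟨φ, hφ, fun j => a (φ j), g, hg⟩
  · refine ConvMax.unit_and_norm_of_tendstoLp h hk
      (fun j => ConvMax.isUnitLp_shift (hunit (φ j)) (a j)) ?_ hg
    refine (hlim.comp hφ.tendsto_atTop).congr fun j => ?_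
    exact (ConvMax.eLpNorm_convOp_shift h hk (hunit _).1 _).symm
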